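/- Let $d\ge 1$ be an odd integer, let $\gamma>1$, and put $\kappa=\frac{\gamma-1}{2}$. Assume that $\gamma\le 1+\frac1{d-1}$ (no upper bound on $\gamma$ is imposed when $d=1$). Consider, for $(t,x)\in\mathbb R\times\mathbb R^d$, the quasilinear form of the isentropic Euler system for a scalar function $c$ (the sound speed) and a velocity field $u$ with values in $\mathbb R^d$: $$\partial_t\bar c+(u\cdot\nabla)\bar c+\kappa\,\bar c\,\operatorname{div}u=0,\qquad \partial_tu+(u\cdot\nabla)u+\kappa\,\bar c\,\nabla\bar c=0,\qquad \bar c:=\frac c\kappa .$$ Then there is no pair $(c,u)$ of functions of class $C^1$ on the whole space-time $\mathbb R^{1+d}$ which solves this system at every $(t,x)\in\mathbb R\times\mathbb R^d$ (an eternal solution, smooth up to vacuum), such that $c(0,\cdot)$ is supported in a compact domain of $\mathbb R^d$ with smooth boundary, and which is non-trivial in the sense that $c\not\equiv0$ on $\mathbb R^{1+d}$. -/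

import Mathlib

open scoped ContDiff Topology Gradient

noncomputable section

namespace EulerVacuum

/-- The divergence `∑ i, ∂ᵢ vᵢ` of a vector field on `ℝᵈ`. -/
def divergence {d : ℕ} (v : EuclideanSpace ℝ (Fin d) → EuclideanSpace ℝ (Fin d))
    (x : EuclideanSpace ℝ (Fin d)) : ℝ :=
  ∑ i : Fin d, (fderiv ℝ v x (EuclideanSpace.single i 1)) i

/-- The exponent `κ = (γ - 1) / 2` of a polytropic gas with adiabatic constant `γ`. -/
def kappa (γ : ℝ) : ℝ := (γ - 1) / 2

/-- The renormalized sound speed `c / κ`. -/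
def renorm {d : ℕ} (γ : ℝ) (c : ℝ → EuclideanSpace ℝ (Fin d) → ℝ) :
    ℝ → EuclideanSpace ℝ (Fin d) → ℝ :=
  fun t x => c t x / kappa γ

/-- `(c, u)`, functions of `(t, x) ∈ ℝ × ℝᵈ`, is an eternal solution of class `C¹` of the
quasilinear symmetric form of the isentropic Euler system, written for the renormalized sound speed
`b = c / κ`:
`∂ₜ b + (u·∇) b + κ b div u = 0` and `∂ₜ u + (u·∇) u + κ b ∇b = 0` on all of `ℝ × ℝᵈ`.
The term `(u·∇) f` is the derivative of `f (t, ·)` in the direction `u (t, x)`. -/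
structure IsEternalSolution {d : ℕ} (γ : ℝ) (c : ℝ → EuclideanSpace ℝ (Fin d) → ℝ)
    (u : ℝ → EuclideanSpace ℝ (Fin d) → EuclideanSpace ℝ (Fin d)) : Prop where
  contDiff_c : ContDiff ℝ 1 (fun p : ℝ × EuclideanSpace ℝ (Fin d) => c p.1 p.2)
  contDiff_u : ContDiff ℝ 1 (fun p : ℝ × EuclideanSpace ℝ (Fin d) => u p.1 p.2)
  mass : ∀ t x,
    deriv (fun s => renorm γ c s x) t + fderiv ℝ (renorm γ c t) x (u t x)
      + kappa γ * renorm γ c t x * divergence (u t) x = 0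
  momentum : ∀ t x,
    deriv (fun s => u s x) t + fderiv ℝ (u t) x (u t x)
      + (kappa γ * renorm γ c t x) • ∇ (renorm γ c t) x = 0

/-- A compact domain with smooth boundary: a compact set `K` that near each of its boundary points
is a sublevel set `{f ≤ 0}` of a smooth function `f` with non-zero differential there. -/
def IsCompactSmoothDomain {d : ℕ} (K : Set (EuclideanSpace ℝ (Fin d))) : Prop :=
  IsCompact K ∧ ∀ p ∈ frontier K, ∃ f : EuclideanSpace ℝ (Fin d) → ℝ,
    ContDiff ℝ ∞ f ∧ fderiv ℝ f p ≠ 0 ∧ ∀ᶠ x in 𝓝 p, (x ∈ K ↔ f x ≤ 0)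

end EulerVacuum

end

/-!
There are no non-trivial eternal solutions because the gas would have to disperse faster than the
region which contains it can grow. Write `B = c / κ`, `ρ = |B| ^ (1 / κ)`, and let the initial
vacuum contain `{‖x‖ > R}`.

**Vacuum.** A particle path issued from a vacuum point is a complete straight line, on which
`u` is constant and the vacuum persists (`IsGasFlow.vacuum_line`): along the line, the deviation of
`u` and `B` solve a homogeneous linear differential inequality. Hence on the vacuum the map
`Φ_t y = y + t u(0, y)` has the inverse `x ↦ x - t u(t, x)`, which is `C¹` on all of space. The set
of vacuum points issued from `{‖y‖ > R}` is open by the inverse function theorem, and a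
connectedness argument shows that it contains a neighbourhood of infinity, locally uniformly in time
(`IsGasFlow.exists_bound_outerVacuum`). So the gas stays bounded, although no bound on `u` is
assumed and the flow of `u` is never constructed.

**Volume.** Let `φ` be a cutoff function `θ`, equal to `1` near the ball of radius `R`, transported by
the particles. Integration by parts against the field `x` gives `∫ φ = -(1/d) ∫ ∇φ·x`, where `∇φ`
lives in the exterior vacuum; with `Φ_t` as coordinates there, and `A` the matrix of `Du(0, ·)`, the
integrand becomes `∇θ · adj(1 + t A) (y + t u(0, y))`. This is a polynomial of degree `d` in `t`
(`IsGasFlow.integral_transportedCutoff`). Since `∫ φ ≥ 0` for positive and negative times and `d` is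
odd, the leading coefficient vanishes, and the volume is `O(t ^ (d - 1))`
(`IsGasFlow.exists_volume_le`).

**Dispersion.** The mass `∫ ρ` is conserved, and the energy `∫ ρ (½ ‖x - t u‖² + t² e)` relative to
free expansion satisfies an identity which gives `∫ |B| ^ (1 / κ + 2) = O(t ^ (-min 2 (2 d κ)))`
(`IsGasFlow.exists_pressure_le`). Both follow from the transport identity
`IsGasFlow.hasDerivAt_integral_density`; as `ρ` is not `C¹` when `κ ≥ 1`, it is obtained by
regularization.

**Conclusion.** Interpolating the mass between the internal energy and the volume, it tends to `0`
as soon as `(d - 1) κ < min 1 (d κ)`, which the bound on `γ` ensures (`IsGasFlow.eq_zero`). Being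
conserved it is then `0` at all times.
-/

namespace EulerVacuum

open Set Filter MeasureTheory

/-! ### The system on space-time -/

/-- The Euclidean space `ℝᵈ`. -/
abbrev Space (d : ℕ) : Type := EuclideanSpace ℝ (Fin d)

/-- The divergence in the space variable of a vector field on `ℝ × ℝᵈ`. -/
noncomputable def spaceDiv {d : ℕ} (U : ℝ × Space d → Space d) (p : ℝ × Space d) : ℝ :=
  ∑ i : Fin d, (fderiv ℝ U p (0, EuclideanSpace.single i 1)) i

/-- A `C¹` solution `(B, U)` of the system for the renormalized sound speed, with the functions
on space-time and the material derivative `∂ₜ + u·∇` as the derivative in the direction `(1, U)`,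
whose vacuum at time `0` contains `{‖x‖ > R}`. The momentum equation is tested against all
vectors `v`, which avoids the gradient. -/
structure IsGasFlow {d : ℕ} (κ R : ℝ) (B : ℝ × Space d → ℝ) (U : ℝ × Space d → Space d) :
    Prop where
  kappa_pos : 0 < κ
  contDiff_B : ContDiff ℝ 1 B
  contDiff_U : ContDiff ℝ 1 U
  mass : ∀ p, fderiv ℝ B p (1, U p) + κ * B p * spaceDiv U p = 0
  momentum : ∀ p v, inner ℝ (fderiv ℝ U p (1, U p)) v + κ * B p * fderiv ℝ B p (0, v) = 0
  vacuum : ∀ x, R < ‖x‖ → B (0, x) = 0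

section Slices

variable {d : ℕ} {F : Type*} [NormedAddCommGroup F] [NormedSpace ℝ F]

theorem hasDerivAt_time {f : ℝ × Space d → F} {t : ℝ} {x : Space d}
    (hf : DifferentiableAt ℝ f (t, x)) :
    HasDerivAt (fun s => f (s, x)) (fderiv ℝ f (t, x) (1, 0)) t := by
  have h1 : HasDerivAt (fun s : ℝ => (s, x)) ((1 : ℝ), (0 : Space d)) t :=
    (hasDerivAt_id t).prodMk (hasDerivAt_const t x)
  exact hf.hasFDerivAt.comp_hasDerivAt t h1

theorem hasFDerivAt_space {f : ℝ × Space d → F} {t : ℝ} {x : Space d}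
    (hf : DifferentiableAt ℝ f (t, x)) :
    HasFDerivAt (fun y => f (t, y))
      ((fderiv ℝ f (t, x)).comp (ContinuousLinearMap.inr ℝ ℝ (Space d))) x := by
  have h1 : HasFDerivAt (fun y : Space d => (t, y)) (ContinuousLinearMap.inr ℝ ℝ (Space d)) x := by
    exact hasFDerivAt_prodMk_right t x
  exact hf.hasFDerivAt.comp x h1

theorem fderiv_one_eq {f : ℝ × Space d → F} (p : ℝ × Space d) (v : Space d) :
    fderiv ℝ f p (1, v) = fderiv ℝ f p (1, 0) + fderiv ℝ f p (0, v) := by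
  rw [← map_add]; simp

theorem continuous_spaceDiv {U : ℝ × Space d → Space d} (hU : ContDiff ℝ 1 U) :
    Continuous (spaceDiv U) := by
  have := hU.continuous_fderiv one_ne_zero
  unfold spaceDiv
  fun_prop

theorem divergence_slice {U : ℝ × Space d → Space d} {t : ℝ} {x : Space d}
    (hU : DifferentiableAt ℝ U (t, x)) : divergence (fun y => U (t, y)) x = spaceDiv U (t, x) := by
  simp [divergence, spaceDiv, (hasFDerivAt_space hU).fderiv]

end Slices

theorem kappa_pos {γ : ℝ} (hγ : 1 < γ) : 0 < kappa γ := by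
  unfold kappa; linarith

theorem IsEternalSolution.isGasFlow {d : ℕ} {γ R : ℝ} {c : ℝ → Space d → ℝ}
    {u : ℝ → Space d → Space d} (hγ : 1 < γ) (h : IsEternalSolution γ c u)
    (hR : ∀ x, R < ‖x‖ → c 0 x = 0) :
    IsGasFlow (kappa γ) R (fun p => renorm γ c p.1 p.2) (fun p => u p.1 p.2) := by
  have hB : ContDiff ℝ 1 (fun p : ℝ × Space d => renorm γ c p.1 p.2) :=
    h.contDiff_c.div_const _
  have dB := hB.differentiable one_ne_zero
  have dU := h.contDiff_u.differentiable one_ne_zero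
  refine ⟨kappa_pos hγ, hB, h.contDiff_u, ?_, ?_, ?_⟩
  · rintro ⟨t, x⟩
    have := h.mass t x
    rw [(hasDerivAt_time (dB (t, x))).deriv] at this
    rw [← divergence_slice (dU (t, x)), fderiv_one_eq]
    have h2 := (hasFDerivAt_space (dB (t, x))).fderiv
    simp only at h2
    rw [show renorm γ c t = fun y => renorm γ c t y from rfl, h2] at this
    simpa using this
  · rintro ⟨t, x⟩ v
    have := h.momentum t x
    rw [(hasDerivAt_time (dU (t, x))).deriv] at this
    have h2 := (hasFDerivAt_space (dU (t, x))).fderiv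
    have h3 := (hasFDerivAt_space (dB (t, x))).fderiv
    simp only at h2 h3
    rw [show u t = fun y => u t y from rfl, h2] at this
    have h4 : inner ℝ (∇ (renorm γ c t) x) v
        = fderiv ℝ (fun p : ℝ × Space d => renorm γ c p.1 p.2) (t, x) (0, v) := by
      rw [gradient, InnerProductSpace.toDual_symm_apply,
        show renorm γ c t = fun y => renorm γ c t y from rfl, h3]
      simp
    have h5 := congrArg (fun w => inner ℝ w v) this
    simp only [inner_add_left, inner_smul_left, h4, inner_zero_left] at h5
    rw [fderiv_one_eq, inner_add_left]
    simpa using h5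
  · intro x hx
    simp [renorm, hR x hx]

namespace IsGasFlow

variable {d : ℕ} {κ R : ℝ} {B : ℝ × Space d → ℝ} {U : ℝ × Space d → Space d}

theorem mono (h : IsGasFlow κ R B U) {R' : ℝ} (hR : R ≤ R') : IsGasFlow κ R' B U :=
  { h with vacuum := fun x hx => h.vacuum x (hR.trans_lt hx) }

theorem differentiable_B (h : IsGasFlow κ R B U) : Differentiable ℝ B :=
  h.contDiff_B.differentiable one_ne_zero

theorem differentiable_U (h : IsGasFlow κ R B U) : Differentiable ℝ U :=
  h.contDiff_U.differentiable one_ne_zero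

/-! ### Vacuum particle paths -/

/-- The momentum equation, tested against the acceleration itself. -/
theorem norm_acceleration_le (h : IsGasFlow κ R B U) (p : ℝ × Space d) :
    ‖fderiv ℝ U p (1, U p)‖ ≤ κ * ‖fderiv ℝ B p‖ * |B p| := by
  set a := fderiv ℝ U p (1, U p) with ha
  rcases eq_or_ne a 0 with h0 | h0
  · have := h.kappa_pos; rw [h0]; simp; positivity
  · have h1 := h.momentum p a
    rw [← ha, real_inner_self_eq_norm_sq] at h1
    have h2 : |fderiv ℝ B p (0, a)| ≤ ‖fderiv ℝ B p‖ * ‖a‖ := by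
      simpa using (fderiv ℝ B p).le_opNorm (0, a)
    have h3 : ‖a‖ * ‖a‖ ≤ κ * ‖fderiv ℝ B p‖ * |B p| * ‖a‖ := by
      calc ‖a‖ * ‖a‖ = -(κ * B p * fderiv ℝ B p (0, a)) := by linarith
        _ ≤ |κ * B p * fderiv ℝ B p (0, a)| := neg_le_abs _
        _ = κ * |B p| * |fderiv ℝ B p (0, a)| := by
          rw [abs_mul, abs_mul, abs_of_pos h.kappa_pos]
        _ ≤ κ * |B p| * (‖fderiv ℝ B p‖ * ‖a‖) := by
          have := h.kappa_pos
          gcongr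
        _ = _ := by ring
    exact le_of_mul_le_mul_right h3 (norm_pos_iff.2 h0)

/-- Particle paths issued from the vacuum are complete straight lines, along which the velocity is
constant and the vacuum persists: along the line `s ↦ (t + s, x + s v)`, `v = U (t, x)`, the pair
`(U - v, B)` solves a homogeneous linear differential inequality with zero initial value. -/
theorem vacuum_line (h : IsGasFlow κ R B U) {t : ℝ} {x : Space d} (h0 : B (t, x) = 0) (δ : ℝ) :
    B (t + δ, x + δ • U (t, x)) = 0 ∧ U (t + δ, x + δ • U (t, x)) = U (t, x) := by
  set v := U (t, x) with hv
  let g : ℝ → ℝ × Space d := fun s => (t + s * δ, x + (s * δ) • v)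
  have hg : ∀ s, HasDerivAt g (δ • ((1 : ℝ), v)) s := by
    intro s
    have h1 : HasDerivAt (fun s : ℝ => s * δ) δ s := by simpa using (hasDerivAt_id s).mul_const δ
    have := (h1.const_add t).prodMk ((h1.smul_const v).const_add x)
    simpa [g] using this
  have hgc : Continuous g := continuous_iff_continuousAt.2 fun s => (hg s).continuousAt
  let z : ℝ → Space d × ℝ := fun s => (U (g s) - v, B (g s))
  let z' : ℝ → Space d × ℝ := fun s =>
    (fderiv ℝ U (g s) (δ • ((1 : ℝ), v)), fderiv ℝ B (g s) (δ • ((1 : ℝ), v)))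
  have hz : ∀ s, HasDerivAt z (z' s) s := by
    intro s
    have h1 := (h.differentiable_U (g s)).hasFDerivAt.comp_hasDerivAt s (hg s)
    have h2 := (h.differentiable_B (g s)).hasFDerivAt.comp_hasDerivAt s (hg s)
    exact (h1.sub_const v).prodMk h2
  have hDU := h.contDiff_U.continuous_fderiv one_ne_zero
  have hDB := h.contDiff_B.continuous_fderiv one_ne_zero
  have hdiv := continuous_spaceDiv h.contDiff_U
  let k : ℝ → ℝ := fun s => |δ| * (κ * ‖fderiv ℝ B (g s)‖ + ‖fderiv ℝ U (g s)‖
    + (κ * |spaceDiv U (g s)| + ‖fderiv ℝ B (g s)‖))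
  have hk : Continuous k := by fun_prop
  obtain ⟨K, hK⟩ := isCompact_Icc.exists_bound_of_continuousOn (hk.continuousOn (s := Icc 0 1))
  have hbound : ∀ s, ‖z' s‖ ≤ k s * ‖z s‖ := by
    intro s
    have hκ := h.kappa_pos
    -- the line is followed with velocity `v` in place of `U`, at the cost of terms in `U - v`
    have e1 : ((1 : ℝ), v) = (1, U (g s)) - (0, U (g s) - v) := by simp
    have hw : ‖U (g s) - v‖ ≤ ‖z s‖ := le_max_left _ _
    have hb : |B (g s)| ≤ ‖z s‖ := le_max_right _ _
    have hw' : ‖((0 : ℝ), U (g s) - v)‖ ≤ ‖z s‖ := by simpa using hw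
    have hU : ‖fderiv ℝ U (g s) (1, v)‖
        ≤ (κ * ‖fderiv ℝ B (g s)‖ + ‖fderiv ℝ U (g s)‖) * ‖z s‖ := by
      rw [e1, map_sub, add_mul]
      refine (norm_sub_le _ _).trans (add_le_add ?_ ?_)
      · exact (h.norm_acceleration_le _).trans (by gcongr)
      · exact ((fderiv ℝ U (g s)).le_opNorm _).trans (by gcongr)
    have hB : ‖fderiv ℝ B (g s) (1, v)‖
        ≤ (κ * |spaceDiv U (g s)| + ‖fderiv ℝ B (g s)‖) * ‖z s‖ := by
      rw [e1, map_sub, add_mul]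
      refine (norm_sub_le _ _).trans (add_le_add ?_ ?_)
      · have : fderiv ℝ B (g s) (1, U (g s)) = -(κ * B (g s) * spaceDiv U (g s)) := by
          linarith [h.mass (g s)]
        rw [this, norm_neg, Real.norm_eq_abs, abs_mul, abs_mul, abs_of_pos hκ, mul_right_comm]
        gcongr
      · exact ((fderiv ℝ B (g s)).le_opNorm _).trans (by gcongr)
    have hz0 : 0 ≤ ‖z s‖ := norm_nonneg _
    refine max_le ?_ ?_
    · simp only [z', map_smul, norm_smul, Real.norm_eq_abs, k, mul_assoc]
      gcongr
      exact hU.trans (mul_le_mul_of_nonneg_right (le_add_of_nonneg_right (by positivity)) hz0)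
    · simp only [z', map_smul, norm_smul, Real.norm_eq_abs, k, mul_assoc]
      gcongr
      exact hB.trans (mul_le_mul_of_nonneg_right (le_add_of_nonneg_left (by positivity)) hz0)
  have key := eq_zero_of_abs_deriv_le_mul_abs_self_of_eq_zero_right (f := z) (f' := z') (K := K)
    (a := 0) (b := 1) (fun s _ => (hz s).continuousAt.continuousWithinAt)
    (fun s _ => (hz s).hasDerivWithinAt) (by simp [z, g, h0, ← hv])
    (fun s hs => (hbound s).trans (by
      gcongr; exact (le_abs_self _).trans (hK s (Ico_subset_Icc_self hs)))) 1 (by simp)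
  simp only [z, g, one_mul, Prod.mk_eq_zero, sub_eq_zero] at key
  exact ⟨key.2, key.1⟩

end IsGasFlow

/-! ### The exterior vacuum -/

/-- The position at time `p.1` of the free particle which starts at `p.2` with its velocity
`U (0, p.2)`. -/
noncomputable def freePath {d : ℕ} (U : ℝ × Space d → Space d) (p : ℝ × Space d) : Space d :=
  p.2 + p.1 • U (0, p.2)

/-- The position at time `0` of the free particle which passes through `p.2` at time `p.1` with
velocity `U p`; on the vacuum this inverts `freePath`. -/
noncomputable def label {d : ℕ} (U : ℝ × Space d → Space d) (p : ℝ × Space d) : Space d :=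
  p.2 - p.1 • U p

/-- The part of the vacuum in space-time which is carried by the particles issued from
`{‖x‖ > R}` at time `0`. -/
def outerVacuum {d : ℕ} (R : ℝ) (B : ℝ × Space d → ℝ) (U : ℝ × Space d → Space d) :
    Set (ℝ × Space d) :=
  {p | B p = 0 ∧ R < ‖label U p‖}

namespace IsGasFlow

variable {d : ℕ} {κ R : ℝ} {B : ℝ × Space d → ℝ} {U : ℝ × Space d → Space d}

theorem contDiff_label (h : IsGasFlow κ R B U) : ContDiff ℝ 1 (label U) := by
  have := h.contDiff_U
  unfold label
  fun_prop

theorem contDiff_freePath (h : IsGasFlow κ R B U) : ContDiff ℝ 1 (freePath U) := by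
  have := h.contDiff_U
  unfold freePath
  fun_prop

theorem vacuum_freePath (h : IsGasFlow κ R B U) {y : Space d} (hy : B (0, y) = 0) (t : ℝ) :
    B (t, freePath U (t, y)) = 0 := by
  simpa [freePath] using (h.vacuum_line hy t).1

theorem label_freePath (h : IsGasFlow κ R B U) {y : Space d} (hy : B (0, y) = 0) (t : ℝ) :
    label U (t, freePath U (t, y)) = y := by
  have := (h.vacuum_line hy t).2
  rw [zero_add] at this
  simp [label, freePath, this]

theorem freePath_label (h : IsGasFlow κ R B U) {p : ℝ × Space d} (hp : B p = 0) :
    freePath U (p.1, label U p) = p.2 := by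
  have := (h.vacuum_line (t := p.1) (x := p.2) hp (-p.1)).2
  have h2 : U (0, label U p) = U p := by simpa [label, sub_eq_add_neg] using this
  simp only [freePath, h2]
  simp [label]

theorem freePath_mem_outerVacuum (h : IsGasFlow κ R B U) {y : Space d} (hy : R < ‖y‖) (t : ℝ) :
    (t, freePath U (t, y)) ∈ outerVacuum R B U :=
  ⟨h.vacuum_freePath (h.vacuum y hy) t, by rwa [h.label_freePath (h.vacuum y hy)]⟩

/-- The exterior vacuum is open: `freePath` has there the `C¹` left inverse `label`, hence an
invertible differential. -/
theorem isOpen_outerVacuum (h : IsGasFlow κ R B U) : IsOpen (outerVacuum R B U) := by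
  rw [isOpen_iff_mem_nhds]
  intro p hp
  let Ψ : ℝ × Space d → ℝ × Space d := fun q => (q.1, freePath U q)
  let Q : ℝ × Space d → ℝ × Space d := fun q => (q.1, label U q)
  have hΨ : ContDiff ℝ 1 Ψ := contDiff_fst.prodMk h.contDiff_freePath
  have hQ : ContDiff ℝ 1 Q := contDiff_fst.prodMk h.contDiff_label
  set q := Q p with hq
  have hΨq : Ψ q = p := by
    simp only [Ψ, q, Q]
    rw [h.freePath_label hp.1]
  have hopen : {r : ℝ × Space d | R < ‖r.2‖} ∈ 𝓝 q := by
    refine (isOpen_lt continuous_const (by fun_prop)).mem_nhds ?_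
    exact hp.2
  have hid : Q ∘ Ψ =ᶠ[𝓝 q] id := by
    filter_upwards [hopen] with r hr
    simp [Q, Ψ, h.label_freePath (h.vacuum _ hr)]
  have hΨ' := (hΨ.contDiffAt (x := q)).hasStrictFDerivAt one_ne_zero
  have hQ' := (hQ.differentiable one_ne_zero (Ψ q)).hasFDerivAt
  have hcomp := (hQ'.comp q hΨ'.hasFDerivAt).unique
    ((hasFDerivAt_id q).congr_of_eventuallyEq hid)
  have hinj : Function.Injective (fderiv ℝ Ψ q : ℝ × Space d →ₗ[ℝ] ℝ × Space d) := by
    intro a b hab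
    have ha := DFunLike.congr_fun hcomp a
    have hb := DFunLike.congr_fun hcomp b
    simp only [ContinuousLinearMap.comp_apply, ContinuousLinearMap.id_apply] at ha hb
    rw [← ha, ← hb]
    exact congrArg _ hab
  have hsurj := LinearMap.range_eq_top.2 (LinearMap.injective_iff_surjective.1 hinj)
  have hmap := hΨ'.map_nhds_eq_of_surj hsurj
  rw [hΨq] at hmap
  rw [← hmap, mem_map]
  filter_upwards [hopen] with r hr
  exact h.freePath_mem_outerVacuum hr r.1

/-- On bounded time intervals everything far from the origin belongs to the exterior vacuum. The
trajectory of the sphere `‖y‖ = R` stays in a ball; on a time segment at a fixed position outside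
this ball, the exterior vacuum is open and closed and contains time `0`. -/
theorem exists_bound_outerVacuum (h : IsGasFlow κ R B U) (T : ℝ) :
    ∃ M, ∀ t x, |t| ≤ T → M < ‖x‖ → (t, x) ∈ outerVacuum R B U := by
  have hcpt : IsCompact (Icc (-T) T ×ˢ Metric.sphere (0 : Space d) R) :=
    isCompact_Icc.prod (isCompact_sphere _ _)
  obtain ⟨M, hM⟩ := hcpt.exists_bound_of_continuousOn h.contDiff_freePath.continuous.continuousOn
  refine ⟨max M R, fun t x ht hx => ?_⟩
  rw [max_lt_iff] at hx
  have hlab := h.contDiff_label.continuous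
  have hB := h.contDiff_B.continuous
  let S : Set ℝ := {s | (s, x) ∈ outerVacuum R B U}
  have hT : 0 ≤ T := (abs_nonneg t).trans ht
  have hsx : Continuous fun s : ℝ => (s, x) := by fun_prop
  have hSo : IsOpen S := h.isOpen_outerVacuum.preimage hsx
  have hSc : IsClosed {s : ℝ | B (s, x) = 0 ∧ R ≤ ‖label U (s, x)‖} :=
    (isClosed_eq (hB.comp hsx) continuous_const).inter
      (isClosed_le continuous_const (hlab.comp hsx).norm)
  have hsub : Icc (-T) T ⊆ S := by
    refine isPreconnected_Icc.subset_of_closure_inter_subset hSo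
      ⟨0, ⟨by simpa using hT, hT⟩, h.vacuum x hx.2, by simpa [label] using hx.2⟩ ?_
    rintro s ⟨hs, hsT⟩
    -- a boundary point of `S` lies on a trajectory of the sphere, hence in the ball of radius `M`
    have hle : S ⊆ {s : ℝ | B (s, x) = 0 ∧ R ≤ ‖label U (s, x)‖} := fun r hr => ⟨hr.1, hr.2.le⟩
    have hs' := closure_minimal hle hSc hs
    refine ⟨hs'.1, lt_of_le_of_ne hs'.2 fun heq => ?_⟩
    have := hM (s, label U (s, x)) ⟨hsT, by simp [heq]⟩
    rw [h.freePath_label hs'.1] at this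
    exact absurd this (not_le.2 hx.1)
  exact hsub (abs_le.1 ht)

end IsGasFlow

/-! ### Integrals over space -/

/-- A function on space-time whose restriction to each bounded time interval vanishes outside a
ball. -/
def HasBoundedSlices {d : ℕ} {F : Type*} [Zero F] (f : ℝ × Space d → F) : Prop :=
  ∀ T : ℝ, ∃ M, ∀ t x, |t| ≤ T → M < ‖x‖ → f (t, x) = 0

section Integrals

variable {d : ℕ} {f : ℝ × Space d → ℝ}

theorem HasBoundedSlices.mono {F G : Type*} [Zero F] [Zero G] {f : ℝ × Space d → F}
    {g : ℝ × Space d → G} (hf : HasBoundedSlices f) (hg : ∀ p, f p = 0 → g p = 0) :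
    HasBoundedSlices g := fun T =>
  let ⟨M, hM⟩ := hf T
  ⟨M, fun t x ht hx => hg _ (hM t x ht hx)⟩

theorem HasBoundedSlices.hasCompactSupport {F : Type*} [Zero F] {f : ℝ × Space d → F}
    (hf : HasBoundedSlices f) (t : ℝ) : HasCompactSupport (fun x => f (t, x)) := by
  obtain ⟨M, hM⟩ := hf |t|
  refine HasCompactSupport.intro (isCompact_closedBall (0 : Space d) M) fun x hx => ?_
  exact hM t x le_rfl (by simpa using hx)

theorem HasBoundedSlices.integrable (hf : HasBoundedSlices f) (hc : Continuous f) (t : ℝ) :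
    Integrable (fun x => f (t, x)) :=
  Continuous.integrable_of_hasCompactSupport (by fun_prop) (hf.hasCompactSupport t)

theorem HasBoundedSlices.fderiv (hf : HasBoundedSlices f) : HasBoundedSlices (fderiv ℝ f) := by
  intro T
  obtain ⟨M, hM⟩ := hf (T + 1)
  refine ⟨M, fun t x ht hx => ?_⟩
  have hev : f =ᶠ[𝓝 (t, x)] fun _ => 0 := by
    have h1 : ∀ᶠ p : ℝ × Space d in 𝓝 (t, x), |p.1| < T + 1 :=
      (isOpen_lt (by fun_prop) continuous_const).mem_nhds
        (show |t| < T + 1 from ht.trans_lt (lt_add_one _))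
    have h2 : ∀ᶠ p : ℝ × Space d in 𝓝 (t, x), M < ‖p.2‖ :=
      (isOpen_lt continuous_const (by fun_prop)).mem_nhds (show M < ‖x‖ from hx)
    filter_upwards [h1, h2] with p hp1 hp2 using hM p.1 p.2 hp1.le hp2
  rw [hev.fderiv_eq]
  simp

theorem hasDerivAt_integral_slice (hf : HasBoundedSlices f) (hc : ContDiff ℝ 1 f) (t : ℝ) :
    HasDerivAt (fun s => ∫ x, f (s, x)) (∫ x, fderiv ℝ f (t, x) (1, 0)) t := by
  have hD := hc.continuous_fderiv one_ne_zero
  obtain ⟨M, hM⟩ := hf.fderiv (|t| + 1)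
  have hcpt : IsCompact (Icc (-(|t| + 1)) (|t| + 1) ×ˢ Metric.closedBall (0 : Space d) M) :=
    isCompact_Icc.prod (isCompact_closedBall _ _)
  have hD1 : Continuous fun p : ℝ × Space d => fderiv ℝ f p (1, 0) := by fun_prop
  obtain ⟨C, hC⟩ := hcpt.exists_bound_of_continuousOn hD1.continuousOn
  have hlt : ∀ s ∈ Metric.ball t 1, |s| ≤ |t| + 1 := by
    intro s hs
    rw [Metric.mem_ball, Real.dist_eq] at hs
    have := abs_add_le (s - t) t
    rw [sub_add_cancel] at this
    linarith
  refine (hasDerivAt_integral_of_dominated_loc_of_deriv_le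
    (F := fun s x => f (s, x)) (F' := fun s x => fderiv ℝ f (s, x) (1, 0))
    (bound := (Metric.closedBall (0 : Space d) M).indicator fun _ => C)
    (Metric.ball_mem_nhds t one_pos) (Eventually.of_forall fun s => ?_)
    (hf.integrable hc.continuous t)
    ?_ (ae_of_all _ fun x s hs => ?_) ?_ (ae_of_all _ fun x s _ => ?_)).2
  · exact (hf.integrable hc.continuous s).aestronglyMeasurable
  · exact (Continuous.aestronglyMeasurable (by fun_prop))
  · by_cases hx : x ∈ Metric.closedBall (0 : Space d) M
    · rw [indicator_of_mem hx]
      exact hC (s, x) ⟨abs_le.1 (hlt s hs), hx⟩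
    · rw [indicator_of_notMem hx, hM s x (hlt s hs) (by simpa using hx)]
      simp
  · exact (integrable_indicator_iff measurableSet_closedBall).2
      (integrableOn_const (isCompact_closedBall _ _).measure_lt_top.ne)
  · exact hasDerivAt_time (hc.differentiable one_ne_zero (s, x))

theorem integral_fderiv_apply_eq_zero {g : Space d → ℝ} (hg : ContDiff ℝ 1 g)
    (hs : HasCompactSupport g) (v : Space d) : ∫ x, fderiv ℝ g x v = 0 := by
  have hD := hg.continuous_fderiv one_ne_zero
  have h1 : Integrable fun x => fderiv ℝ g x v :=
    Continuous.integrable_of_hasCompactSupport (by fun_prop) (hs.fderiv_apply ℝ v)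
  have := integral_mul_fderiv_eq_neg_fderiv_mul_of_integrable (μ := (volume : Measure (Space d)))
    (f := fun _ => (1 : ℝ)) (g := g) (v := v) (by simp) (by simpa using h1)
    (by simpa using hg.continuous.integrable_of_hasCompactSupport hs) (fun x _ => by fun_prop)
    (fun x _ => hg.differentiable one_ne_zero x)
  simpa using this

theorem integral_divergence_eq_zero {W : Space d → Space d} (hW : ContDiff ℝ 1 W)
    (hs : HasCompactSupport W) : ∫ x, divergence W x = 0 := by
  have hD := hW.continuous_fderiv one_ne_zero
  have hcomp : ∀ i x v, fderiv ℝ (fun y => W y i) x v = (fderiv ℝ W x v) i := by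
    intro i x v
    have := ((EuclideanSpace.proj (𝕜 := ℝ) i).hasFDerivAt.comp x
      (hW.differentiable one_ne_zero x).hasFDerivAt).fderiv
    exact DFunLike.congr_fun this v
  have hi : ∀ i, ContDiff ℝ 1 fun y => W y i := by
    intro i; fun_prop
  have hsi : ∀ i, HasCompactSupport fun y => W y i := fun i =>
    hs.comp_left (g := fun w : Space d => w i) rfl
  unfold divergence
  rw [integral_finsetSum]
  · refine Finset.sum_eq_zero fun i _ => ?_
    simp_rw [← hcomp]
    exact integral_fderiv_apply_eq_zero (hi i) (hsi i) _
  · intro i _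
    simp_rw [← hcomp]
    have := (hi i).continuous_fderiv one_ne_zero
    exact Continuous.integrable_of_hasCompactSupport (by fun_prop) ((hsi i).fderiv_apply ℝ _)

theorem divergence_smul {g : Space d → ℝ} {W : Space d → Space d} {x : Space d}
    (hg : DifferentiableAt ℝ g x) (hW : DifferentiableAt ℝ W x) :
    divergence (fun y => g y • W y) x = fderiv ℝ g x (W x) + g x * divergence W x := by
  unfold divergence
  rw [fderiv_fun_smul hg hW, Finset.mul_sum]
  have : fderiv ℝ g x (W x) = ∑ i, fderiv ℝ g x (EuclideanSpace.single i 1) * W x i := by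
    conv_lhs => rw [← (EuclideanSpace.basisFun (Fin d) ℝ).sum_repr (W x)]
    simp [mul_comm]
  rw [this, ← Finset.sum_add_distrib]
  refine Finset.sum_congr rfl fun i _ => ?_
  simp [add_comm]

/-- Integration by parts against a vector field: `∫ W·∇g = -∫ g div W`. -/
theorem integral_fderiv_apply_field {g : Space d → ℝ} {W : Space d → Space d}
    (hg : ContDiff ℝ 1 g) (hW : ContDiff ℝ 1 W) (hs : HasCompactSupport g) :
    ∫ x, fderiv ℝ g x (W x) = -∫ x, g x * divergence W x := by
  have hDg := hg.continuous_fderiv one_ne_zero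
  have hDW := hW.continuous_fderiv one_ne_zero
  have h : ∫ x, divergence (fun y => g y • W y) x = 0 :=
    integral_divergence_eq_zero (hg.smul hW) hs.smul_right
  have hW0 := hW.continuous
  have hg0 := hg.continuous
  have hdiv : Continuous (divergence W) := by
    unfold divergence; fun_prop
  have hsum : ∀ x, divergence (fun y => g y • W y) x
      = fderiv ℝ g x (W x) + g x * divergence W x := fun x =>
    divergence_smul (hg.differentiable one_ne_zero x) (hW.differentiable one_ne_zero x)
  have hsf : HasCompactSupport fun x => fderiv ℝ g x (W x) :=
    (hs.fderiv ℝ).mono fun x hx => by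
      rw [Function.mem_support] at hx ⊢
      exact fun h0 => hx (by simp [h0])
  simp_rw [hsum] at h
  have hi1 : Integrable fun x => fderiv ℝ g x (W x) :=
    Continuous.integrable_of_hasCompactSupport (by fun_prop) hsf
  have hi2 : Integrable fun x => g x * divergence W x :=
    Continuous.integrable_of_hasCompactSupport (by fun_prop) hs.mul_right
  rw [integral_add hi1 hi2] at h
  linarith

/-- Reynolds' transport theorem. -/
theorem hasDerivAt_integral_transport {U : ℝ × Space d → Space d} (hU : ContDiff ℝ 1 U)
    (hf : HasBoundedSlices f) (hc : ContDiff ℝ 1 f) (t : ℝ) :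
    HasDerivAt (fun s => ∫ x, f (s, x))
      (∫ x, (fderiv ℝ f (t, x) (1, U (t, x)) + f (t, x) * spaceDiv U (t, x))) t := by
  convert hasDerivAt_integral_slice hf hc t using 1
  have hfx : ContDiff ℝ 1 fun x => f (t, x) := by fun_prop
  have hUx : ContDiff ℝ 1 fun x => U (t, x) := by fun_prop
  have hD := hc.continuous_fderiv one_ne_zero
  have hU0 := hU.continuous
  have hf0 := hc.continuous
  have hdiv := continuous_spaceDiv hU
  have key := integral_fderiv_apply_field hfx hUx (hf.hasCompactSupport t)
  have h1 : ∀ x v, fderiv ℝ (fun y => f (t, y)) x v = fderiv ℝ f (t, x) (0, v) := fun x v => by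
    simp [(hasFDerivAt_space (hc.differentiable one_ne_zero (t, x))).fderiv]
  have h2 : ∀ x, divergence (fun y => U (t, y)) x = spaceDiv U (t, x) := fun x =>
    divergence_slice (hU.differentiable one_ne_zero (t, x))
  simp_rw [h1, h2] at key
  have hi : ∀ V : ℝ × Space d → ℝ × Space d, Continuous V →
      Integrable fun x => fderiv ℝ f (t, x) (V (t, x)) := fun V hV =>
    HasBoundedSlices.integrable (f := fun p => fderiv ℝ f p (V p))
      (hf.fderiv.mono fun p hp => by simp [hp]) (by fun_prop) t
  have hi3 : Integrable fun x => f (t, x) * spaceDiv U (t, x) :=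
    HasBoundedSlices.integrable (f := fun p => f p * spaceDiv U p)
      (hf.mono fun p hp => by simp [hp]) (by fun_prop) t
  rw [integral_add (hi (fun p => (1, U p)) (by fun_prop)) hi3]
  have hsplit : ∀ x, fderiv ℝ f (t, x) (1, U (t, x))
      = fderiv ℝ f (t, x) (1, 0) + fderiv ℝ f (t, x) (0, U (t, x)) := fun x => fderiv_one_eq _ _
  simp_rw [hsplit]
  rw [integral_add (hi (fun p => (1, 0)) (by fun_prop)) (hi (fun p => (0, U p)) (by fun_prop)), key]
  ring

end Integrals

/-! ### Transport of the mass density -/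

/-- A `C¹` approximation of `|b| ^ p` as `η → 0`, also for `p ≤ 1`. The power `η ^ 4` makes the
error uniformly small on bounded sets, see `regPow_error_le`. -/
noncomputable def regPow (p η b : ℝ) : ℝ := |b| ^ (p + 2) / (b ^ 2 + η ^ 4)

theorem abs_rpow_add_two {p : ℝ} (hp : 0 < p) (b : ℝ) : |b| ^ (p + 2) = |b| ^ p * b ^ 2 := by
  rcases eq_or_ne b 0 with rfl | hb
  · simp [Real.zero_rpow (show p + 2 ≠ 0 by linarith)]
  · rw [Real.rpow_add (abs_pos.2 hb)]
    norm_cast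
    simp

theorem contDiff_regPow {p η : ℝ} (hp : 0 < p) (hη : 0 < η) : ContDiff ℝ 1 (regPow p η) := by
  have h1 : ContDiff ℝ 1 fun b : ℝ => ‖b‖ ^ (p + 2) := contDiff_norm_rpow (by linarith)
  have h2 : ContDiff ℝ 1 fun b : ℝ => b ^ 2 + η ^ 4 := by fun_prop
  exact h1.div h2 fun b => by positivity

theorem mul_deriv_regPow {p η : ℝ} (hp : 0 < p) (hη : 0 < η) (b : ℝ) :
    b * deriv (regPow p η) b
      = p * regPow p η b + 2 * (regPow p η b * (η ^ 4 / (b ^ 2 + η ^ 4))) := by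
  have h1 := hasDerivAt_abs_rpow b (show 1 < p + 2 by linarith)
  have h2 : HasDerivAt (fun b : ℝ => b ^ 2 + η ^ 4) (2 * b) b := by
    simpa using (hasDerivAt_pow 2 b).add_const (η ^ 4)
  have h0 : b ^ 2 + η ^ 4 ≠ 0 := by positivity
  have h3 : HasDerivAt (regPow p η) _ b := h1.div h2 h0
  rw [h3.deriv, regPow, add_sub_cancel_right, abs_rpow_add_two hp]
  field_simp
  ring

theorem abs_rpow_sub_regPow {p η : ℝ} (hp : 0 < p) (hη : 0 < η) (b : ℝ) :
    |b| ^ p - regPow p η b = |b| ^ p * (η ^ 4 / (b ^ 2 + η ^ 4)) := by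
  have h0 : b ^ 2 + η ^ 4 ≠ 0 := by positivity
  rw [regPow, abs_rpow_add_two hp]
  field_simp
  ring

theorem regPow_nonneg (p η b : ℝ) : 0 ≤ regPow p η b := by
  unfold regPow; positivity

theorem regPow_le {p η : ℝ} (hp : 0 < p) (hη : 0 < η) (b : ℝ) : regPow p η b ≤ |b| ^ p := by
  rw [← sub_nonneg, abs_rpow_sub_regPow hp hη]
  positivity

theorem regPow_error_le {p η b C : ℝ} (hp : 0 < p) (hη : 0 < η) (hb : |b| ≤ C) :
    |b| ^ p * (η ^ 4 / (b ^ 2 + η ^ 4)) ≤ η ^ p + C ^ p * η ^ 2 := by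
  have hC : 0 ≤ C := (abs_nonneg b).trans hb
  rcases le_total |b| η with h | h
  · calc |b| ^ p * (η ^ 4 / (b ^ 2 + η ^ 4)) ≤ η ^ p * 1 := by
          gcongr
          rw [div_le_one (by positivity)]
          nlinarith [sq_nonneg b]
      _ ≤ _ := by rw [mul_one]; exact le_add_of_nonneg_right (by positivity)
  · have hb2 : η ^ 2 ≤ b ^ 2 := by rw [← sq_abs b]; gcongr
    calc |b| ^ p * (η ^ 4 / (b ^ 2 + η ^ 4)) ≤ C ^ p * η ^ 2 := by
          gcongr
          rw [div_le_iff₀ (by positivity)]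
          nlinarith [sq_nonneg η, pow_pos hη 4, pow_pos hη 6]
      _ ≤ _ := le_add_of_nonneg_left (by positivity)

theorem continuous_abs_rpow {p : ℝ} (hp : 0 < p) : Continuous fun b : ℝ => |b| ^ p :=
  continuous_abs.rpow_const fun _ => Or.inr hp.le

namespace IsGasFlow

variable {d : ℕ} {κ R : ℝ} {B : ℝ × Space d → ℝ} {U : ℝ × Space d → Space d}

theorem hasBoundedSlices (h : IsGasFlow κ R B U) : HasBoundedSlices B := fun T =>
  let ⟨M, hM⟩ := h.exists_bound_outerVacuum T
  ⟨M, fun t x ht hx => (hM t x ht hx).1⟩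

theorem integrable_slice (h : IsGasFlow κ R B U) {g : ℝ × Space d → ℝ} (hg : Continuous g)
    (h0 : ∀ p, B p = 0 → g p = 0) (t : ℝ) : Integrable fun x => g (t, x) :=
  (h.hasBoundedSlices.mono h0).integrable hg t

theorem continuous_abs_B_rpow (h : IsGasFlow κ R B U) {p : ℝ} (hp : 0 < p) :
    Continuous fun q => |B q| ^ p :=
  (continuous_abs_rpow hp).comp h.contDiff_B.continuous

/-- Integrals of functions which approximate `g` up to the error of `regPow` times a continuous
weight converge, uniformly on bounded time intervals. -/
theorem tendstoUniformlyOn_integral (h : IsGasFlow κ R B U) {p : ℝ} (hp : 0 < p) (T : ℝ)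
    {w g : ℝ × Space d → ℝ} {G : ℝ → ℝ × Space d → ℝ} (hw : Continuous w)
    (hg : ∀ t, Integrable fun x => g (t, x))
    (hG : ∀ η, 0 < η → ∀ t, Integrable fun x => G η (t, x))
    (hle : ∀ η, 0 < η → ∀ q,
      |g q - G η q| ≤ |B q| ^ p * (η ^ 4 / (B q ^ 2 + η ^ 4)) * |w q|) :
    TendstoUniformlyOn (fun η t => ∫ x, G η (t, x)) (fun t => ∫ x, g (t, x)) (𝓝[>] 0)
      (Ioo (-T) T) := by
  obtain ⟨M, hM⟩ := h.hasBoundedSlices T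
  have hcpt : IsCompact (Icc (-T) T ×ˢ Metric.closedBall (0 : Space d) M) :=
    isCompact_Icc.prod (isCompact_closedBall _ _)
  obtain ⟨C, hC⟩ := hcpt.exists_bound_of_continuousOn h.contDiff_B.continuous.continuousOn
  obtain ⟨L, hL⟩ := hcpt.exists_bound_of_continuousOn hw.continuousOn
  have hlim : Tendsto (fun η : ℝ => (η ^ p + C ^ p * η ^ 2) * L
      * volume.real (Metric.closedBall (0 : Space d) M)) (𝓝[>] 0) (𝓝 0) := by
    refine tendsto_nhdsWithin_of_tendsto_nhds ?_
    have : Continuous fun η : ℝ => (η ^ p + C ^ p * η ^ 2) * L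
        * volume.real (Metric.closedBall (0 : Space d) M) := by
      have := Real.continuous_rpow_const hp.le
      fun_prop
    simpa [Real.zero_rpow hp.ne'] using this.tendsto 0
  have hfin : volume (Metric.closedBall (0 : Space d) M) < ⊤ :=
    (isCompact_closedBall _ _).measure_lt_top
  rw [Metric.tendstoUniformlyOn_iff]
  intro e he
  filter_upwards [hlim.eventually (gt_mem_nhds he), self_mem_nhdsWithin] with η hηe hη t ht
  rw [mem_Ioi] at hη
  refine lt_of_le_of_lt ?_ hηe
  rw [Real.dist_eq, ← integral_sub (hg t) (hG η hη t)]
  have ht' : |t| ≤ T := abs_le.2 ⟨ht.1.le, ht.2.le⟩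
  rw [← Real.norm_eq_abs, ← setIntegral_eq_integral_of_forall_compl_eq_zero
    (s := Metric.closedBall (0 : Space d) M)]
  · refine norm_setIntegral_le_of_norm_le_const (f := fun x => g (t, x) - G η (t, x)) hfin
      fun x hx => ?_
    have hmem : (t, x) ∈ Icc (-T) T ×ˢ Metric.closedBall (0 : Space d) M :=
      ⟨abs_le.1 ht', hx⟩
    refine (hle η hη (t, x)).trans (mul_le_mul (regPow_error_le hp hη (hC _ hmem)) (hL _ hmem)
      (abs_nonneg _) ?_)
    exact (by positivity : (0 : ℝ) ≤ _).trans (regPow_error_le hp hη (hC _ hmem))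
  · intro x hx
    have := hle η hη (t, x)
    rw [hM t x ht' (by simpa using hx)] at this
    simpa [Real.zero_rpow hp.ne'] using this

/-- The quantity `∫ |B|^(1/κ) f` evolves by the material derivative of `f`: the density
`|B|^(1/κ)` solves the continuity equation, in a weak sense since it need not be `C¹`. -/
theorem hasDerivAt_integral_density (h : IsGasFlow κ R B U) {f : ℝ × Space d → ℝ}
    (hf : ContDiff ℝ 1 f) (t : ℝ) :
    HasDerivAt (fun s => ∫ x, |B (s, x)| ^ κ⁻¹ * f (s, x))
      (∫ x, |B (t, x)| ^ κ⁻¹ * fderiv ℝ f (t, x) (1, U (t, x))) t := by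
  have hκ := h.kappa_pos
  have hp : 0 < κ⁻¹ := inv_pos.2 hκ
  set p := κ⁻¹ with hpdef
  have hU0 := h.contDiff_U.continuous
  have hB0 := h.contDiff_B.continuous
  have hf0 := hf.continuous
  have hDf := hf.continuous_fderiv one_ne_zero
  have hdiv := continuous_spaceDiv h.contDiff_U
  have hBp := h.continuous_abs_B_rpow hp
  have hreg : ∀ η, 0 < η → Continuous fun q => regPow p η (B q) := fun η hη =>
    (contDiff_regPow hp hη).continuous.comp hB0
  have hreg0 : ∀ η, regPow p η 0 = 0 := fun η => by
    simp [regPow, Real.zero_rpow (show p + 2 ≠ 0 by linarith)]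
  have h0p : |(0 : ℝ)| ^ p = 0 := by simp [Real.zero_rpow hp.ne']
  have hi : ∀ g : ℝ × Space d → ℝ, Continuous g → ∀ s,
      Integrable fun x => |B (s, x)| ^ p * g (s, x) := fun g hg s =>
    h.integrable_slice (hBp.mul hg) (fun q hq => by simp only [Pi.mul_apply, hq, h0p, zero_mul]) s
  have hden : ∀ η, 0 < η → Continuous fun q => η ^ 4 / (B q ^ 2 + η ^ 4) := fun η hη => by
    refine Continuous.div (by fun_prop) (by fun_prop) fun q => by positivity
  let G' : ℝ → ℝ × Space d → ℝ := fun η q => regPow p η (B q) * fderiv ℝ f q (1, U q)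
    - 2 * κ * (regPow p η (B q) * (η ^ 4 / (B q ^ 2 + η ^ 4))) * (f q * spaceDiv U q)
  have hG'c : ∀ η, 0 < η → Continuous (G' η) := fun η hη => by
    have := hreg η hη
    have := hden η hη
    fun_prop
  have hderiv : ∀ η, 0 < η → ∀ s, HasDerivAt (fun s => ∫ x, regPow p η (B (s, x)) * f (s, x))
      (∫ x, G' η (s, x)) s := by
    intro η hη s
    have hC1 : ContDiff ℝ 1 fun q => regPow p η (B q) * f q :=
      ((contDiff_regPow hp hη).comp h.contDiff_B).mul hf
    have key := hasDerivAt_integral_transport h.contDiff_U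
      (h.hasBoundedSlices.mono fun q hq => by simp [hq, hreg0]) hC1 s
    convert key using 3 with x
    have hd1 : HasFDerivAt (fun q => regPow p η (B q))
        (deriv (regPow p η) (B (s, x)) • fderiv ℝ B (s, x)) (s, x) :=
      ((contDiff_regPow hp hη).differentiable one_ne_zero _).hasDerivAt.comp_hasFDerivAt _
        (h.differentiable_B (s, x)).hasFDerivAt
    have hd2 := (hd1.mul (hf.differentiable one_ne_zero (s, x)).hasFDerivAt).fderiv
    have hm : fderiv ℝ B (s, x) (1, U (s, x)) = -(κ * B (s, x) * spaceDiv U (s, x)) := by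
      linarith [h.mass (s, x)]
    have hr := mul_deriv_regPow hp hη (B (s, x))
    have hκp : κ * p = 1 := mul_inv_cancel₀ hκ.ne'
    simp only [Pi.mul_def] at hd2
    rw [hd2]
    simp only [G', add_apply, smul_apply, smul_eq_mul, hm]
    linear_combination (κ * f (s, x) * spaceDiv U (s, x)) * hr
      + (regPow p η (B (s, x)) * f (s, x) * spaceDiv U (s, x)) * hκp
  have hlim0 : ∀ s, Tendsto (fun η => ∫ x, regPow p η (B (s, x)) * f (s, x)) (𝓝[>] 0)
      (𝓝 (∫ x, |B (s, x)| ^ p * f (s, x))) := by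
    intro s
    refine (h.tendstoUniformlyOn_integral hp (|s| + 1) hf0
      (G := fun η q => regPow p η (B q) * f q) (g := fun q => |B q| ^ p * f q)
      (hi f hf0)
      (fun η hη => h.integrable_slice ((hreg η hη).mul hf0) fun q hq => by simp [hq, hreg0])
      fun η hη q => ?_).tendsto_at (abs_lt.1 (lt_add_one |s|))
    rw [← sub_mul, abs_rpow_sub_regPow hp hη, abs_mul, abs_of_nonneg (by positivity)]
  refine hasDerivAt_of_tendstoUniformlyOn (l := 𝓝[>] (0 : ℝ)) (isOpen_Ioo
    (a := -(|t| + 1)) (b := |t| + 1))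
    (f := fun η s => ∫ x, regPow p η (B (s, x)) * f (s, x)) (f' := fun η s => ∫ x, G' η (s, x))
    (g' := fun s => ∫ x, |B (s, x)| ^ p * fderiv ℝ f (s, x) (1, U (s, x)))
    ?_ ?_ (fun s _ => hlim0 s) (abs_lt.1 (lt_add_one |t|))
  · refine h.tendstoUniformlyOn_integral hp (|t| + 1) (G := G')
      (w := fun q => |fderiv ℝ f q (1, U q)| + 2 * κ * |f q * spaceDiv U q|)
      (g := fun q => |B q| ^ p * fderiv ℝ f q (1, U q)) (by fun_prop)
      (hi (fun q => fderiv ℝ f q (1, U q)) (by fun_prop))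
      (fun η hη => h.integrable_slice (hG'c η hη) fun q hq => by simp [G', hq, hreg0])
      fun η hη q => ?_
    have e1 : |B q| ^ p * fderiv ℝ f q (1, U q) - G' η q
        = |B q| ^ p * (η ^ 4 / (B q ^ 2 + η ^ 4)) * fderiv ℝ f q (1, U q)
          + 2 * κ * (regPow p η (B q) * (η ^ 4 / (B q ^ 2 + η ^ 4))) * (f q * spaceDiv U q) := by
      simp only [G']
      rw [← abs_rpow_sub_regPow hp hη]
      ring
    have hn := regPow_nonneg p η (B q)
    have hl := regPow_le hp hη (B q)
    rw [e1, abs_of_nonneg (a := |fderiv ℝ f q (1, U q)| + _) (by positivity), mul_add]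
    refine (abs_add_le _ _).trans (add_le_add ?_ ?_)
    · rw [abs_mul, abs_of_nonneg (by positivity)]
    · rw [abs_mul, abs_of_nonneg (by positivity)]
      calc 2 * κ * (regPow p η (B q) * (η ^ 4 / (B q ^ 2 + η ^ 4))) * |f q * spaceDiv U q|
          ≤ 2 * κ * (|B q| ^ p * (η ^ 4 / (B q ^ 2 + η ^ 4))) * |f q * spaceDiv U q| := by gcongr
        _ = _ := by ring
  · filter_upwards [self_mem_nhdsWithin] with η hη s _ using hderiv η hη s

end IsGasFlow

/-! ### Mass conservation and dispersion -/

namespace IsGasFlow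

variable {d : ℕ} {κ R : ℝ} {B : ℝ × Space d → ℝ} {U : ℝ × Space d → Space d}

theorem integral_density_eq (h : IsGasFlow κ R B U) (s t : ℝ) :
    ∫ x, |B (s, x)| ^ κ⁻¹ = ∫ x, |B (t, x)| ^ κ⁻¹ := by
  have hd : ∀ r, HasDerivAt (fun s => ∫ x, |B (s, x)| ^ κ⁻¹) 0 r := fun r => by
    simpa using h.hasDerivAt_integral_density (f := fun _ => 1) contDiff_const r
  exact is_const_of_deriv_eq_zero (fun r => (hd r).differentiableAt) (fun r => (hd r).deriv) s t

theorem hasFDerivAt_label (h : IsGasFlow κ R B U) (q : ℝ × Space d) :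
    HasFDerivAt (label U) (ContinuousLinearMap.snd ℝ ℝ (Space d)
      - (q.1 • fderiv ℝ U q + (ContinuousLinearMap.fst ℝ ℝ (Space d)).smulRight (U q))) q :=
  hasFDerivAt_snd.sub (hasFDerivAt_fst.smul (h.differentiable_U q).hasFDerivAt)

theorem spaceDiv_label (h : IsGasFlow κ R B U) (q : ℝ × Space d) :
    spaceDiv (label U) q = d - q.1 * spaceDiv U q := by
  simp [spaceDiv, (h.hasFDerivAt_label q).fderiv, Finset.sum_sub_distrib, Finset.mul_sum]

/-- The density of the energy `½ ‖x - t u‖² + t² e` relative to free expansion, per unit of mass.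
The specific internal energy is `e = κ B² / (2 (2 κ + 1))`. -/
noncomputable def expansionEnergy (κ : ℝ) (B : ℝ × Space d → ℝ) (U : ℝ × Space d → Space d)
    (q : ℝ × Space d) : ℝ :=
  1 / 2 * ‖label U q‖ ^ 2 + κ / (2 * (2 * κ + 1)) * (q.1 ^ 2 * B q ^ 2)

theorem contDiff_expansionEnergy (h : IsGasFlow κ R B U) :
    ContDiff ℝ 1 (expansionEnergy κ B U) := by
  have h1 := h.contDiff_label
  have h2 := h.contDiff_B
  unfold expansionEnergy
  exact (contDiff_const.mul (h1.norm_sq ℝ)).add (by fun_prop)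

theorem fderiv_expansionEnergy (h : IsGasFlow κ R B U) (q : ℝ × Space d) :
    fderiv ℝ (expansionEnergy κ B U) q (1, U q)
      = q.1 * κ * B q * fderiv ℝ B q (0, label U q)
        + κ / (2 * κ + 1) * (q.1 * B q ^ 2 - κ * q.1 ^ 2 * B q ^ 2 * spaceDiv U q) := by
  have h1 := ((h.hasFDerivAt_label q).norm_sq).const_mul (1 / 2)
  have h2 := (((hasFDerivAt_fst (𝕜 := ℝ) (p := q)).pow 2).mul
    ((h.differentiable_B q).hasFDerivAt.pow 2)).const_mul (κ / (2 * (2 * κ + 1)))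
  have h3 := (h1.add h2).fderiv
  have h4 : expansionEnergy κ B U = (fun y => 1 / 2 * ‖label U y‖ ^ 2)
      + fun y => κ / (2 * (2 * κ + 1)) * ((fun p : ℝ × Space d => p.1) ^ 2 * B ^ 2) y := by
    funext p; simp [expansionEnergy]
  have hm : fderiv ℝ B q (1, U q) = -(κ * B q * spaceDiv U q) := by linarith [h.mass q]
  have hv := h.momentum q (label U q)
  rw [real_inner_comm] at hv
  have hκ := h.kappa_pos
  rw [h4]
  refine (DFunLike.congr_fun h3 (1, U q)).trans ?_
  simp [hm]
  field_simp
  linear_combination (-q.1 * (2 * κ + 1)) * hv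

/-- The dispersion identity: `d/dt (∫ ρ (½ ‖x - t u‖² + t² e))` is a multiple of the total internal
energy, the factor having the sign of `t (1 - d κ)`. -/
theorem hasDerivAt_expansionEnergy (h : IsGasFlow κ R B U) (t : ℝ) :
    HasDerivAt (fun s => ∫ x, |B (s, x)| ^ κ⁻¹ * expansionEnergy κ B U (s, x))
      (t * (κ / (2 * κ + 1)) * (1 - d * κ) * ∫ x, |B (t, x)| ^ (κ⁻¹ + 2)) t := by
  convert h.hasDerivAt_integral_density h.contDiff_expansionEnergy t using 1
  have hκ := h.kappa_pos
  have hp : 0 < κ⁻¹ := inv_pos.2 hκ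
  have hB := h.contDiff_B.continuous
  have hU := h.contDiff_U.continuous
  have hdiv := continuous_spaceDiv h.contDiff_U
  have hlab := h.contDiff_label
  set p := κ⁻¹ with hpdef
  have h0 : |(0 : ℝ)| ^ (p + 2) = 0 := by
    simp [Real.zero_rpow (show p + 2 ≠ 0 by linarith)]
  have hPc : ContDiff ℝ 1 fun b : ℝ => |b| ^ (p + 2) :=
    contDiff_norm_rpow (E := ℝ) (by linarith)
  let P : ℝ × Space d → ℝ := fun q => |B q| ^ (p + 2)
  have hP : ContDiff ℝ 1 P := hPc.comp h.contDiff_B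
  have hP0 := hP.continuous
  have hDP := hP.continuous_fderiv one_ne_zero
  have hPs : HasBoundedSlices P := h.hasBoundedSlices.mono fun q hq => by simp only [P, hq, h0]
  have hDPq : ∀ q w, fderiv ℝ P q w = (p + 2) * |B q| ^ p * B q * fderiv ℝ B q w := fun q w => by
    have h1 := (hasDerivAt_abs_rpow (B q) (show 1 < p + 2 by linarith)).comp_hasFDerivAt q
      (h.differentiable_B q).hasFDerivAt
    rw [add_sub_cancel_right] at h1
    have h2 : fderiv ℝ P q = _ := h1.fderiv
    rw [h2]
    simp
  have hibp := integral_fderiv_apply_field (g := fun x => P (t, x)) (W := fun x => label U (t, x))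
    (by fun_prop) (by fun_prop) (hPs.hasCompactSupport t)
  have h1 : ∀ x v, fderiv ℝ (fun y => P (t, y)) x v = fderiv ℝ P (t, x) (0, v) := fun x v => by
    simp [(hasFDerivAt_space (hP.differentiable one_ne_zero (t, x))).fderiv]
  have h2 : ∀ x, divergence (fun y => label U (t, y)) x = d - t * spaceDiv U (t, x) := fun x => by
    rw [divergence_slice (hlab.differentiable one_ne_zero (t, x)), h.spaceDiv_label]
  simp_rw [h1, h2] at hibp
  have hlab0 := hlab.continuous
  have i1 : Integrable fun x => fderiv ℝ P (t, x) (0, label U (t, x)) :=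
    HasBoundedSlices.integrable (f := fun q => fderiv ℝ P q (0, label U q))
      (hPs.fderiv.mono fun q hq => by simp [hq]) (by fun_prop) t
  have i2 : Integrable fun x => P (t, x) * (d - t * spaceDiv U (t, x)) :=
    HasBoundedSlices.integrable (f := fun q => P q * (d - t * spaceDiv U q))
      (hPs.mono fun q hq => by simp [hq]) (by fun_prop) t
  have i3 : Integrable fun x => P (t, x) := hPs.integrable hP0 t
  have hγ : 2 * κ + 1 ≠ 0 := by positivity
  have hκp : κ * p = 1 := mul_inv_cancel₀ hκ.ne'
  have hpt : ∀ x, |B (t, x)| ^ p * fderiv ℝ (expansionEnergy κ B U) (t, x) (1, U (t, x))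
      = t * κ ^ 2 / (2 * κ + 1) * fderiv ℝ P (t, x) (0, label U (t, x))
        + (t * κ ^ 2 / (2 * κ + 1) * (P (t, x) * (d - t * spaceDiv U (t, x)))
        + t * (κ / (2 * κ + 1)) * (1 - d * κ) * P (t, x)) := fun x => by
    rw [h.fderiv_expansionEnergy, hDPq]
    simp only [P]
    rw [abs_rpow_add_two hp]
    field_simp
    linear_combination (-t * |B (t, x)| ^ p * B (t, x)
      * fderiv ℝ B (t, x) (0, label U (t, x))) * hκp
  simp_rw [hpt]
  have i23 : Integrable fun x => t * κ ^ 2 / (2 * κ + 1) * (P (t, x) * (d - t * spaceDiv U (t, x)))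
      + t * (κ / (2 * κ + 1)) * (1 - d * κ) * P (t, x) := (i2.const_mul _).add (i3.const_mul _)
  rw [integral_add (i1.const_mul _) i23,
    integral_add (i2.const_mul _) (i3.const_mul _), integral_const_mul, integral_const_mul,
    integral_const_mul, hibp]
  ring

theorem integrable_pressure (h : IsGasFlow κ R B U) (t : ℝ) :
    Integrable fun x => |B (t, x)| ^ (κ⁻¹ + 2) := by
  have hp : 0 < κ⁻¹ + 2 := by have := inv_pos.2 h.kappa_pos; linarith
  exact h.integrable_slice (h.continuous_abs_B_rpow hp)
    (fun q hq => by simp only [hq, abs_zero, Real.zero_rpow hp.ne']) t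

/-- The total internal energy decays at least like `t ^ (-min 2 (2 d κ))`. -/
theorem exists_pressure_le (h : IsGasFlow κ R B U) :
    ∃ C, ∀ t, 1 ≤ t →
      ∫ x, |B (t, x)| ^ (κ⁻¹ + 2) ≤ C * t ^ (max 0 (2 - 2 * d * κ) - 2) := by
  have hκ := h.kappa_pos
  have hp : 0 < κ⁻¹ := inv_pos.2 hκ
  set m := max 0 (2 - 2 * (d : ℝ) * κ) with hm
  have hm0 : 0 ≤ m := le_max_left _ _
  have hm1 : 2 - 2 * (d : ℝ) * κ ≤ m := le_max_right _ _
  let N : ℝ → ℝ := fun t => ∫ x, |B (t, x)| ^ (κ⁻¹ + 2)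
  have hN : ∀ t, 0 ≤ N t := fun t => integral_nonneg fun x => by positivity
  let H : ℝ → ℝ := fun s => ∫ x, |B (s, x)| ^ κ⁻¹ * expansionEnergy κ B U (s, x)
  have hH : ∀ t, HasDerivAt H (t * (κ / (2 * κ + 1)) * (1 - d * κ) * N t) t :=
    h.hasDerivAt_expansionEnergy
  have hHN : ∀ t, κ / (2 * (2 * κ + 1)) * t ^ 2 * N t ≤ H t := by
    intro t
    have hec := h.contDiff_expansionEnergy.continuous
    have hbc := h.continuous_abs_B_rpow hp
    simp only [H, N]
    rw [← integral_const_mul]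
    refine integral_mono ((h.integrable_pressure t).const_mul _)
      (h.integrable_slice (hbc.mul hec) (fun q hq => by
        simp [hq, Real.zero_rpow (inv_ne_zero hκ.ne')]) t) fun x => ?_
    simp only [expansionEnergy, abs_rpow_add_two hp]
    have : 0 ≤ |B (t, x)| ^ κ⁻¹ * (1 / 2 * ‖label U (t, x)‖ ^ 2) := by positivity
    linarith
  -- Grönwall for `H' ≤ (m / t) H`
  have hA : AntitoneOn (fun t => t ^ (-m) * H t) (Ici 1) := by
    have hder : ∀ t, 1 ≤ t → HasDerivAt (fun t => t ^ (-m) * H t)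
        (-m * t ^ (-m - 1) * H t
          + t ^ (-m) * (t * (κ / (2 * κ + 1)) * (1 - d * κ) * N t)) t := fun t ht =>
      (Real.hasDerivAt_rpow_const (Or.inl (by linarith))).mul (hH t)
    refine antitoneOn_of_deriv_nonpos (convex_Ici 1)
      (fun t ht => (hder t ht).continuousAt.continuousWithinAt)
      (fun t ht => ?_) fun t ht => ?_
    · rw [interior_Ici] at ht
      exact (hder t ht.le).differentiableAt.differentiableWithinAt
    · rw [interior_Ici, mem_Ioi] at ht
      have ht0 : 0 < t := by linarith
      rw [(hder t ht.le).deriv]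
      have e : t ^ (-m) = t ^ (-m - 1) * t := by
        rw [Real.rpow_sub_one ht0.ne']; field_simp
      rw [e]
      have hpos : 0 < t ^ (-m - 1) := Real.rpow_pos_of_pos ht0 _
      have hle : t * (t * (κ / (2 * κ + 1)) * (1 - d * κ) * N t) ≤ m * H t := by
        calc t * (t * (κ / (2 * κ + 1)) * (1 - d * κ) * N t)
            = (2 - 2 * d * κ) * (κ / (2 * (2 * κ + 1)) * t ^ 2 * N t) := by
              field_simp
          _ ≤ m * (κ / (2 * (2 * κ + 1)) * t ^ 2 * N t) := by
              have := hN t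
              gcongr
          _ ≤ m * H t := by gcongr; exact hHN t
      nlinarith
  refine ⟨2 * (2 * κ + 1) / κ * H 1, fun t ht => ?_⟩
  have ht0 : 0 < t := by linarith
  have h1 := hA (mem_Ici.2 le_rfl) (mem_Ici.2 ht) ht
  simp only [Real.one_rpow, one_mul] at h1
  rw [Real.rpow_neg ht0.le, inv_mul_le_iff₀ (Real.rpow_pos_of_pos ht0 _)] at h1
  have h2 := (hHN t).trans h1
  rw [Real.rpow_sub ht0, Real.rpow_two]
  change N t ≤ _
  have e : N t = 2 * (2 * κ + 1) / κ / t ^ 2 * (κ / (2 * (2 * κ + 1)) * t ^ 2 * N t) := by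
    field_simp
  rw [e]
  calc _ ≤ 2 * (2 * κ + 1) / κ / t ^ 2 * (t ^ m * H 1) := by gcongr
    _ = _ := by ring

end IsGasFlow

/-! ### Growth of the volume -/

section LinearAlgebra

variable {d : ℕ}

/-- Multiplying the inverse of `M` by `det M` gives the adjugate, here in coordinates and tested
against a linear form. -/
theorem det_mul_apply_of_comp_eq_id {M L : Space d →L[ℝ] Space d}
    (hLM : L.comp M = ContinuousLinearMap.id ℝ (Space d)) {A : Matrix (Fin d) (Fin d) ℝ}
    (hA : LinearMap.toMatrix (EuclideanSpace.basisFun (Fin d) ℝ).toBasis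
      (EuclideanSpace.basisFun (Fin d) ℝ).toBasis (M : Space d →ₗ[ℝ] Space d) = A)
    (ℓ : Space d →L[ℝ] ℝ) (x : Space d) :
    M.det = A.det ∧ A.det ≠ 0 ∧ A.det * ℓ (L x)
      = ∑ i, ℓ (EuclideanSpace.single i 1) * ∑ j, A.adjugate i j * x j := by
  set b := (EuclideanSpace.basisFun (Fin d) ℝ).toBasis with hb
  set N := LinearMap.toMatrix b b (L : Space d →ₗ[ℝ] Space d) with hN
  have hNA : N * A = 1 := by
    rw [← hA, hN, ← LinearMap.toMatrix_comp]
    have : (L : Space d →ₗ[ℝ] Space d) ∘ₗ (M : Space d →ₗ[ℝ] Space d) = LinearMap.id := by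
      ext1 y
      exact DFunLike.congr_fun hLM y
    rw [this, LinearMap.toMatrix_id]
  have hdet : N.det * A.det = 1 := by rw [← Matrix.det_mul, hNA, Matrix.det_one]
  have hadj : A.adjugate = A.det • N := by
    calc A.adjugate = N * A * A.adjugate := by rw [hNA, one_mul]
      _ = A.det • N := by rw [mul_assoc, Matrix.mul_adjugate]; simp
  refine ⟨?_, right_ne_zero_of_mul_eq_one hdet, ?_⟩
  · rw [← hA, LinearMap.det_toMatrix]
  · have hL : ∀ i, (L x) i = ∑ j, N i j * x j := by
      intro i
      have := congrFun (LinearMap.toMatrix_mulVec_repr b b (L : Space d →ₗ[ℝ] Space d) x) i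
      simpa [hb, Matrix.mulVec, dotProduct] using this.symm
    have hℓ : ℓ (L x) = ∑ i, ℓ (EuclideanSpace.single i 1) * (L x) i := by
      conv_lhs => rw [← (EuclideanSpace.basisFun (Fin d) ℝ).sum_repr (L x)]
      simp [mul_comm]
    rw [hℓ, Finset.mul_sum]
    refine Finset.sum_congr rfl fun i _ => ?_
    rw [hL, hadj, mul_left_comm, Finset.mul_sum]
    simp [mul_assoc]

theorem contDiff_adjugate {P : Type*} [NormedAddCommGroup P] [NormedSpace ℝ P]
    {N : P → Matrix (Fin d) (Fin d) ℝ} (hN : ∀ i j, ContDiff ℝ 1 fun p => N p i j) (i j : Fin d) :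
    ContDiff ℝ 1 fun p => (N p).adjugate i j := by
  simp_rw [Matrix.adjugate_apply, Matrix.det_apply']
  refine ContDiff.sum fun σ _ => contDiff_const.mul (contDiff_prod fun k _ => ?_)
  simp_rw [Matrix.updateRow_apply]
  split_ifs
  · exact contDiff_const
  · exact hN _ _

end LinearAlgebra

theorem exists_abs_sub_le_of_contDiff {d : ℕ} {P : Type*} [NormedAddCommGroup P] [NormedSpace ℝ P]
    {g : ℝ × P → ℝ} (hg : ContDiff ℝ 1 g) {a : Space d → P} (ha : Continuous a) (r : ℝ) :
    ∃ C, ∀ s, |s| ≤ 1 → ∀ y ∈ Metric.closedBall (0 : Space d) r,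
      |g (s, a y) - g (0, a y)| ≤ C * |s| := by
  have hcpt : IsCompact (Icc (-1 : ℝ) 1 ×ˢ Metric.closedBall (0 : Space d) r) :=
    isCompact_Icc.prod (isCompact_closedBall _ _)
  have hD := hg.continuous_fderiv one_ne_zero
  have hc : Continuous fun q : ℝ × Space d => fderiv ℝ g (q.1, a q.2) (1, 0) := by fun_prop
  obtain ⟨C, hC⟩ := hcpt.exists_bound_of_continuousOn hc.continuousOn
  refine ⟨C, fun s hs y hy => ?_⟩
  have hder : ∀ σ ∈ Icc (-1 : ℝ) 1,
      HasDerivWithinAt (fun σ => g (σ, a y)) (fderiv ℝ g (σ, a y) (1, 0)) (Icc (-1) 1) σ := by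
    intro σ _
    have h1 : HasDerivAt (fun σ : ℝ => (σ, a y)) ((1 : ℝ), (0 : P)) σ :=
      (hasDerivAt_id σ).prodMk (hasDerivAt_const σ (a y))
    exact ((hg.differentiable one_ne_zero _).hasFDerivAt.comp_hasDerivAt σ h1).hasDerivWithinAt
  simpa using (convex_Icc (-1 : ℝ) 1).norm_image_sub_le_of_norm_hasDerivWithin_le hder
    (fun σ hσ => hC (σ, y) ⟨hσ, hy⟩) (show (0 : ℝ) ∈ Icc (-1) 1 by simp) (abs_le.1 hs)

/-- If `V t` is `-t ^ d W (1 / t) / d` for all `t ≠ 0` and is nonnegative, then in odd degree `d`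
the sign change of `t ^ d` forces `W 0 = 0`, and `V` grows like `t ^ (d - 1)` only. -/
theorem le_mul_pow_of_odd {d : ℕ} (hd : Odd d) {V W : ℝ → ℝ} {C : ℝ} (hV : ∀ t, 0 ≤ V t)
    (hVW : ∀ t, t ≠ 0 → d * V t = -(t ^ d * W t⁻¹))
    (hW : ∀ s, |s| ≤ 1 → |W s - W 0| ≤ C * |s|) {t : ℝ} (ht : 1 ≤ t) :
    V t ≤ C * t ^ (d - 1) := by
  have hd1 : (1 : ℝ) ≤ d := by exact_mod_cast hd.pos
  have hneg : ∀ s, 0 < s → W s ≤ 0 := by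
    intro s hs
    have h1 := hVW s⁻¹ (inv_ne_zero hs.ne')
    rw [inv_inv] at h1
    have h2 : 0 < s⁻¹ ^ d := pow_pos (inv_pos.2 hs) d
    by_contra! h3
    nlinarith [hV s⁻¹, mul_pos h2 h3]
  have hpos : ∀ s, s < 0 → 0 ≤ W s := by
    intro s hs
    have h1 := hVW s⁻¹ (inv_ne_zero hs.ne)
    rw [inv_inv] at h1
    have h2 : s⁻¹ ^ d < 0 := hd.pow_neg (inv_lt_zero.2 hs)
    by_contra! h3
    nlinarith [hV s⁻¹, mul_pos_of_neg_of_neg h2 h3]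
  have hC : 0 ≤ C := by
    have := (abs_nonneg _).trans (hW 1 (by simp))
    simpa using this
  have hsmall : ∀ e, 0 < e → ∃ s, 0 < s ∧ s ≤ 1 ∧ C * s ≤ e := by
    intro e he
    refine ⟨min 1 (e / (C + 1)), by positivity, min_le_left _ _, ?_⟩
    calc C * min 1 (e / (C + 1)) ≤ (C + 1) * (e / (C + 1)) := by
          gcongr
          · linarith
          · exact min_le_right _ _
      _ = e := by field_simp
  have hW0 : W 0 = 0 := by
    refine le_antisymm (le_of_forall_pos_le_add fun e he => ?_)
      (le_of_forall_pos_le_add fun e he => ?_)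
    · obtain ⟨s, hs, hs1, hse⟩ := hsmall e he
      have h1 := (abs_le.1 (hW s (by rwa [abs_of_pos hs]))).1
      rw [abs_of_pos hs] at h1
      linarith [hneg s hs]
    · obtain ⟨s, hs, hs1, hse⟩ := hsmall e he
      have h1 := (abs_le.1 (hW (-s) (by rwa [abs_neg, abs_of_pos hs]))).2
      rw [abs_neg, abs_of_pos hs] at h1
      linarith [hpos (-s) (by linarith)]
  have ht0 : 0 < t := by linarith
  have h1 := hVW t ht0.ne'
  have h2 := hW t⁻¹ (by rw [abs_of_pos (inv_pos.2 ht0)]; exact inv_le_one_of_one_le₀ ht)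
  rw [hW0, sub_zero, abs_of_pos (inv_pos.2 ht0)] at h2
  calc V t ≤ d * V t := le_mul_of_one_le_left (hV t) hd1
    _ = t ^ d * (-W t⁻¹) := by rw [h1]; ring
    _ ≤ t ^ d * (C * t⁻¹) := by
        gcongr
        exact (neg_le_abs _).trans h2
    _ = C * t ^ (d - 1) := by
        obtain ⟨k, rfl⟩ := Nat.exists_eq_succ_of_ne_zero hd.pos.ne'
        rw [Nat.succ_eq_add_one, Nat.add_sub_cancel, pow_succ]
        field_simp

/-- The matrix `(∂ⱼ Uᵢ)` of the space derivative of the initial velocity at `y`. -/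
noncomputable def velocityGradient {d : ℕ} (U : ℝ × Space d → Space d) (y : Space d) :
    Fin d → Fin d → ℝ :=
  fun i j => (fderiv ℝ U (0, y) (0, EuclideanSpace.single j 1)) i

open Classical in
/-- The function equal to `1` off the exterior vacuum and to the initial profile `θ` transported by
the free particles on it. For a cutoff `θ` it is a smooth substitute for the indicator function of
the region inside the particles issued from a large sphere. -/
noncomputable def transportedCutoff {d : ℕ} (R : ℝ) (B : ℝ × Space d → ℝ)
    (U : ℝ × Space d → Space d) (θ : Space d → ℝ) (t : ℝ) (x : Space d) : ℝ :=
  if (t, x) ∈ outerVacuum R B U then θ (label U (t, x)) else 1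

/-- The flux integrand of `transportedCutoff` at time `1 / s`, multiplied by `s ^ d`. In this form
it extends smoothly to `s = 0`. The arguments are the velocity gradient, the position, the velocity
and the differential of the cutoff. -/
noncomputable def rescaledFlux (d : ℕ)
    (q : ℝ × (Fin d → Fin d → ℝ) × Space d × Space d × (Fin d → ℝ)) : ℝ :=
  ∑ i, q.2.2.2.2 i * ∑ j, (q.1 • (1 : Matrix (Fin d) (Fin d) ℝ) + Matrix.of q.2.1).adjugate i j
    * (q.1 * q.2.2.1 j + q.2.2.2.1 j)

theorem contDiff_rescaledFlux (d : ℕ) : ContDiff ℝ 1 (rescaledFlux d) := by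
  unfold rescaledFlux
  have h : ∀ i j, ContDiff ℝ 1
      fun q : ℝ × (Fin d → Fin d → ℝ) × Space d × Space d × (Fin d → ℝ) =>
        (q.1 • (1 : Matrix (Fin d) (Fin d) ℝ) + Matrix.of q.2.1).adjugate i j := fun i j =>
    contDiff_adjugate (fun i j => by
      simp only [Matrix.add_apply, Matrix.smul_apply, Matrix.of_apply]
      fun_prop) i j
  fun_prop

theorem rescaledFlux_inv {d : ℕ} (hd : d ≠ 0) {t : ℝ} (ht : t ≠ 0)
    (A : Fin d → Fin d → ℝ) (x v : Space d) (ℓ : Fin d → ℝ) :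
    t ^ d * rescaledFlux d (t⁻¹, A, x, v, ℓ)
      = ∑ i, ℓ i * ∑ j, (1 + t • Matrix.of A).adjugate i j * (x + t • v) j := by
  have h1 : (1 : Matrix (Fin d) (Fin d) ℝ) + t • Matrix.of A
      = t • (t⁻¹ • (1 : Matrix (Fin d) (Fin d) ℝ) + Matrix.of A) := by
    rw [smul_add, smul_smul, mul_inv_cancel₀ ht, one_smul]
  obtain ⟨k, rfl⟩ := Nat.exists_eq_succ_of_ne_zero hd
  rw [h1, Matrix.adjugate_smul]
  simp only [rescaledFlux, Finset.mul_sum]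
  refine Finset.sum_congr rfl fun i _ => Finset.sum_congr rfl fun j _ => ?_
  simp only [Matrix.smul_apply, PiLp.add_apply, PiLp.smul_apply, smul_eq_mul, Fintype.card_fin,
    Nat.succ_eq_add_one, Nat.add_sub_cancel]
  field_simp
  ring

namespace IsGasFlow

variable {d : ℕ} {κ R : ℝ} {B : ℝ × Space d → ℝ} {U : ℝ × Space d → Space d}

theorem hasFDerivAt_freePath (h : IsGasFlow κ R B U) (t : ℝ) (y : Space d) :
    HasFDerivAt (fun y => freePath U (t, y)) (ContinuousLinearMap.id ℝ (Space d)
      + t • (fderiv ℝ U (0, y)).comp (ContinuousLinearMap.inr ℝ ℝ (Space d))) y :=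
  (hasFDerivAt_id y).add ((hasFDerivAt_space (h.differentiable_U (0, y))).const_smul t)

theorem hasFDerivAt_label_slice (h : IsGasFlow κ R B U) (t : ℝ) (x : Space d) :
    HasFDerivAt (fun y => label U (t, y))
      ((fderiv ℝ (label U) (t, x)).comp (ContinuousLinearMap.inr ℝ ℝ (Space d))) x :=
  hasFDerivAt_space (h.contDiff_label.differentiable one_ne_zero (t, x))

/-- The differentials of `label` and `freePath` at a fixed time are inverse to each other. -/
theorem label_comp_freePath_deriv (h : IsGasFlow κ R B U) (t : ℝ) {y : Space d} (hy : R < ‖y‖) :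
    ((fderiv ℝ (label U) (t, freePath U (t, y))).comp
      (ContinuousLinearMap.inr ℝ ℝ (Space d))).comp (ContinuousLinearMap.id ℝ (Space d)
      + t • (fderiv ℝ U (0, y)).comp (ContinuousLinearMap.inr ℝ ℝ (Space d)))
      = ContinuousLinearMap.id ℝ (Space d) := by
  refine ((h.hasFDerivAt_label_slice t (freePath U (t, y))).comp y
    (h.hasFDerivAt_freePath t y)).unique ((hasFDerivAt_id y).congr_of_eventuallyEq ?_)
  filter_upwards [(isOpen_lt continuous_const continuous_norm).mem_nhds hy] with z hz
  exact h.label_freePath (h.vacuum z hz) t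

theorem toMatrix_freePath_deriv (t : ℝ) (y : Space d) :
    LinearMap.toMatrix (EuclideanSpace.basisFun (Fin d) ℝ).toBasis
      (EuclideanSpace.basisFun (Fin d) ℝ).toBasis
      ((ContinuousLinearMap.id ℝ (Space d)
      + t • (fderiv ℝ U (0, y)).comp (ContinuousLinearMap.inr ℝ ℝ (Space d)) :
        Space d →L[ℝ] Space d) : Space d →ₗ[ℝ] Space d)
      = 1 + t • Matrix.of (velocityGradient U y) := by
  ext i j
  simp [LinearMap.toMatrix_apply, velocityGradient, Matrix.one_apply]

/-- The Jacobian determinant of the free motion never vanishes, and it is `1` at time `0`. -/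
theorem det_freePath_pos (h : IsGasFlow κ R B U) (t : ℝ) {y : Space d} (hy : R < ‖y‖) :
    0 < (1 + t • Matrix.of (velocityGradient U y)).det := by
  have hne : ∀ s : ℝ, (1 + s • Matrix.of (velocityGradient U y)).det ≠ 0 := fun s =>
    (det_mul_apply_of_comp_eq_id (h.label_comp_freePath_deriv s hy)
      (toMatrix_freePath_deriv s y) 0 0).2.1
  have hc : Continuous fun s : ℝ => (1 + s • Matrix.of (velocityGradient U y)).det := by fun_prop
  by_contra! hle
  obtain ⟨s, hs⟩ := mem_range_of_exists_le_of_exists_ge hc ⟨t, hle⟩ ⟨0, by simp⟩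
  exact hne s hs

section Cutoff

variable {θ : Space d → ℝ} {r r' : ℝ}

theorem transportedCutoff_eq_one (hr : ∀ y, ‖y‖ < r → θ y = 1) {t : ℝ} {x : Space d}
    (hx : ¬ (B (t, x) = 0 ∧ r ≤ ‖label U (t, x)‖)) : transportedCutoff R B U θ t x = 1 := by
  unfold transportedCutoff
  split_ifs with h1
  · refine hr _ ?_
    by_contra! h2
    exact hx ⟨h1.1, h2⟩
  · rfl

theorem eventually_transportedCutoff_eq_one (h : IsGasFlow κ R B U)
    (hr : ∀ y, ‖y‖ < r → θ y = 1) {t : ℝ} {x : Space d}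
    (hx : ¬ (B (t, x) = 0 ∧ r ≤ ‖label U (t, x)‖)) :
    transportedCutoff R B U θ t =ᶠ[𝓝 x] fun _ => 1 := by
  have htx : Continuous fun x : Space d => (t, x) := by fun_prop
  have hc : IsClosed {x | B (t, x) = 0 ∧ r ≤ ‖label U (t, x)‖} :=
    (isClosed_eq (h.contDiff_B.continuous.comp htx) continuous_const).inter
      (isClosed_le continuous_const (h.contDiff_label.continuous.comp htx).norm)
  filter_upwards [hc.isOpen_compl.mem_nhds hx] with y hy using transportedCutoff_eq_one hr hy

theorem eventually_transportedCutoff_eq (h : IsGasFlow κ R B U) {t : ℝ} {x : Space d}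
    (hx : (t, x) ∈ outerVacuum R B U) :
    transportedCutoff R B U θ t =ᶠ[𝓝 x] fun x => θ (label U (t, x)) := by
  have htx : Continuous fun x : Space d => (t, x) := by fun_prop
  filter_upwards [(h.isOpen_outerVacuum.preimage htx).mem_nhds hx] with y hy using if_pos hy

theorem contDiff_transportedCutoff (h : IsGasFlow κ R B U) (hθ : ContDiff ℝ 1 θ) (hRr : R < r)
    (hr : ∀ y, ‖y‖ < r → θ y = 1) (t : ℝ) : ContDiff ℝ 1 (transportedCutoff R B U θ t) := by
  rw [contDiff_iff_contDiffAt]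
  intro x
  by_cases hx : (t, x) ∈ outerVacuum R B U
  · have hlab := h.contDiff_label
    have : ContDiff ℝ 1 fun x => θ (label U (t, x)) := by fun_prop
    exact this.contDiffAt.congr_of_eventuallyEq (h.eventually_transportedCutoff_eq hx)
  · exact contDiffAt_const.congr_of_eventuallyEq (h.eventually_transportedCutoff_eq_one hr
      fun hx' => hx ⟨hx'.1, hRr.trans_le hx'.2⟩)

theorem hasCompactSupport_transportedCutoff (h : IsGasFlow κ R B U) (hRr' : R ≤ r')
    (hr' : ∀ y, r' < ‖y‖ → θ y = 0) (t : ℝ) :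
    HasCompactSupport (transportedCutoff R B U θ t) := by
  obtain ⟨M, hM⟩ := (h.mono hRr').exists_bound_outerVacuum |t|
  refine HasCompactSupport.intro (isCompact_closedBall (0 : Space d) M) fun x hx => ?_
  obtain ⟨h1, h2⟩ := hM t x le_rfl (by simpa using hx)
  rw [transportedCutoff, if_pos ⟨h1, hRr'.trans_lt h2⟩, hr' _ h2]

/-- The flux formula: `∫ φ = -(1/d) ∫ ∇φ·x` for the transported cutoff `φ`. As `∇φ` is supported in
the exterior vacuum, the free particles serve as coordinates there, and the integrand becomes a
polynomial of degree `d` in `t`. -/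
theorem integral_transportedCutoff (h : IsGasFlow κ R B U) (hd : d ≠ 0) (hθ : ContDiff ℝ 1 θ)
    (hRr : R < r) (hr : ∀ y, ‖y‖ < r → θ y = 1) (hRr' : R ≤ r') (hr' : ∀ y, r' < ‖y‖ → θ y = 0)
    {t : ℝ} (ht : t ≠ 0) :
    d * ∫ x, transportedCutoff R B U θ t x = -(t ^ d * ∫ y, rescaledFlux d (t⁻¹,
      velocityGradient U y, y, U (0, y), fun i => fderiv ℝ θ y (EuclideanSpace.single i 1))) := by
  set φ := transportedCutoff R B U θ t with hφ
  have hibp := integral_fderiv_apply_field (W := fun x => x)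
    (h.contDiff_transportedCutoff hθ hRr hr t) contDiff_id
    (h.hasCompactSupport_transportedCutoff hRr' hr' t)
  have hdiv : ∀ x : Space d, divergence (fun x : Space d => x) x = d := fun x => by
    simp [divergence]
  simp_rw [hdiv, integral_mul_const] at hibp
  rw [← hφ] at hibp
  let O : Set (Space d) := {y | R < ‖y‖}
  have hO : IsOpen O := isOpen_lt continuous_const continuous_norm
  let Φ : Space d → Space d := fun y => freePath U (t, y)
  have himg : ∀ x, x ∉ Φ '' O → (t, x) ∉ outerVacuum R B U := fun x hx hx' =>
    hx ⟨label U (t, x), hx'.2, h.freePath_label hx'.1⟩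
  have hinj : InjOn Φ O := fun y hy z hz hyz => by
    rw [← h.label_freePath (h.vacuum y hy) t, ← h.label_freePath (h.vacuum z hz) t]
    exact congrArg (fun x => label U (t, x)) hyz
  have hzero : ∀ x, x ∉ Φ '' O → fderiv ℝ φ x x = 0 := fun x hx => by
    have hx' : ¬ (B (t, x) = 0 ∧ r ≤ ‖label U (t, x)‖) := fun hx' =>
      himg x hx ⟨hx'.1, hRr.trans_le hx'.2⟩
    rw [(h.eventually_transportedCutoff_eq_one hr hx').fderiv_eq]
    simp
  have hcov := integral_image_eq_integral_abs_det_fderiv_smul volume hO.measurableSet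
    (fun y _ => (h.hasFDerivAt_freePath t y).hasFDerivWithinAt) hinj (fun x => fderiv ℝ φ x x)
  rw [setIntegral_eq_integral_of_forall_compl_eq_zero hzero] at hcov
  have hpt : ∀ y ∈ O, |(ContinuousLinearMap.id ℝ (Space d)
      + t • (fderiv ℝ U (0, y)).comp (ContinuousLinearMap.inr ℝ ℝ (Space d))).det|
        • fderiv ℝ φ (Φ y) (Φ y) = t ^ d * rescaledFlux d (t⁻¹,
      velocityGradient U y, y, U (0, y), fun i => fderiv ℝ θ y (EuclideanSpace.single i 1)) := by
    intro y hy
    have hx := h.freePath_mem_outerVacuum hy t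
    have hlab : HasFDerivAt (fun x => θ (label U (t, x)))
        ((fderiv ℝ θ (label U (t, Φ y))).comp ((fderiv ℝ (label U) (t, Φ y)).comp
          (ContinuousLinearMap.inr ℝ ℝ (Space d)))) (Φ y) :=
      (hθ.differentiable one_ne_zero _).hasFDerivAt.comp (Φ y)
        (h.hasFDerivAt_label_slice t (Φ y))
    rw [(h.eventually_transportedCutoff_eq hx).fderiv_eq, hlab.fderiv,
      h.label_freePath (h.vacuum y hy) t, rescaledFlux_inv hd ht]
    obtain ⟨h1, -, h2⟩ := det_mul_apply_of_comp_eq_id (h.label_comp_freePath_deriv t hy)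
      (toMatrix_freePath_deriv t y) (fderiv ℝ θ y) (Φ y)
    rw [h1, abs_of_pos (h.det_freePath_pos t hy), smul_eq_mul]
    exact h2
  rw [setIntegral_congr_fun hO.measurableSet hpt, integral_const_mul,
    setIntegral_eq_integral_of_forall_compl_eq_zero] at hcov
  · rw [← hcov, hibp]
    ring
  · intro y hy
    have hy' : ‖y‖ < r := (not_lt.1 hy).trans_lt hRr
    have hev : θ =ᶠ[𝓝 y] fun _ => 1 := by
      filter_upwards [(isOpen_lt continuous_norm continuous_const).mem_nhds hy'] with z hz
      exact hr z hz
    simp [rescaledFlux, hev.fderiv_eq]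

end Cutoff

/-- In odd dimension the gas is contained in a region whose volume grows at most like
`t ^ (d - 1)`. The region is given by a smooth majorant `φ` of its indicator function. -/
theorem exists_volume_le (h : IsGasFlow κ R B U) (hd : Odd d) :
    ∃ (φ : ℝ → Space d → ℝ) (C : ℝ), (∀ t, Integrable (φ t)) ∧ (∀ t x, 0 ≤ φ t x) ∧
      (∀ t x, B (t, x) ≠ 0 → φ t x = 1) ∧ ∀ t, 1 ≤ t → ∫ x, φ t x ≤ C * t ^ (d - 1) := by
  let θ : ContDiffBump (0 : Space d) := ⟨|R| + 1, |R| + 2, by positivity, by linarith⟩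
  have hR := le_abs_self R
  have hθ : ContDiff ℝ 1 θ := θ.contDiff
  have hr : ∀ y, ‖y‖ < |R| + 1 → θ y = 1 := fun y hy =>
    θ.one_of_mem_closedBall (by simpa [θ] using hy.le)
  have hr' : ∀ y, |R| + 2 < ‖y‖ → θ y = 0 := fun y hy =>
    θ.zero_of_le_dist (by simpa [θ] using hy.le)
  let a : Space d → (Fin d → Fin d → ℝ) × Space d × Space d × (Fin d → ℝ) := fun y =>
    (velocityGradient U y, y, U (0, y), fun i => fderiv ℝ θ y (EuclideanSpace.single i 1))
  have hDU := h.contDiff_U.continuous_fderiv one_ne_zero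
  have hU := h.contDiff_U.continuous
  have hDθ := hθ.continuous_fderiv one_ne_zero
  have hA : Continuous fun y : Space d => velocityGradient U y := by
    refine continuous_pi fun i => continuous_pi fun j => ?_
    simp only [velocityGradient]
    fun_prop
  have ha : Continuous a := by
    simp only [a]
    fun_prop
  obtain ⟨C, hC⟩ := exists_abs_sub_le_of_contDiff (contDiff_rescaledFlux d) ha (|R| + 2)
  have hsupp : ∀ s, ∀ y ∉ Metric.closedBall (0 : Space d) (|R| + 2),
      rescaledFlux d (s, a y) = 0 := fun s y hy => by
    have hy' : |R| + 2 < ‖y‖ := by simpa using hy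
    have hev : θ =ᶠ[𝓝 y] fun _ => 0 := by
      filter_upwards [(isOpen_lt continuous_const continuous_norm).mem_nhds hy'] with z hz
      exact hr' z hz
    simp [rescaledFlux, a, hev.fderiv_eq]
  have hflux := (contDiff_rescaledFlux d).continuous
  have hint : ∀ s, Integrable fun y => rescaledFlux d (s, a y) := fun s =>
    Continuous.integrable_of_hasCompactSupport (by fun_prop)
      (HasCompactSupport.intro (isCompact_closedBall _ _) (hsupp s))
  have hfin : volume (Metric.closedBall (0 : Space d) (|R| + 2)) < ⊤ :=
    (isCompact_closedBall _ _).measure_lt_top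
  have hφc : ∀ t, ContDiff ℝ 1 (transportedCutoff R B U θ t) :=
    h.contDiff_transportedCutoff hθ (by linarith) hr
  have hφs : ∀ t, HasCompactSupport (transportedCutoff R B U θ t) :=
    h.hasCompactSupport_transportedCutoff (by linarith) hr'
  have hφ0 : ∀ t x, 0 ≤ transportedCutoff R B U θ t x := fun t x => by
    unfold transportedCutoff
    split_ifs
    · exact θ.nonneg
    · exact zero_le_one
  refine ⟨transportedCutoff R B U θ,
    C * volume.real (Metric.closedBall (0 : Space d) (|R| + 2)),
    fun t => (hφc t).continuous.integrable_of_hasCompactSupport (hφs t), hφ0,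
    fun t x hx => transportedCutoff_eq_one hr fun h0 => hx h0.1, fun t ht => ?_⟩
  refine le_mul_pow_of_odd hd (V := fun t => ∫ x, transportedCutoff R B U θ t x)
    (W := fun s => ∫ y, rescaledFlux d (s, a y)) (fun t => integral_nonneg (hφ0 t))
    (fun t ht => h.integral_transportedCutoff hd.pos.ne' hθ (by linarith) hr (by linarith) hr' ht)
    (fun s hs => ?_) ht
  rw [← integral_sub (hint s) (hint 0), ← Real.norm_eq_abs,
    ← setIntegral_eq_integral_of_forall_compl_eq_zero
      (s := Metric.closedBall (0 : Space d) (|R| + 2))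
      (fun y hy => by rw [hsupp s y hy, hsupp 0 y hy, sub_zero])]
  refine (norm_setIntegral_le_of_norm_le_const
    (f := fun y => rescaledFlux d (s, a y) - rescaledFlux d (0, a y)) hfin
    fun y hy => hC s hs y hy).trans_eq ?_
  ring

end IsGasFlow

/-! ### Non-existence -/

/-- Interpolation between the mass, the internal energy and the volume: the conserved mass is
bounded by `λ⁻² ∫ |B|^(1/κ + 2) + λ^(1/κ) vol` for every `λ > 0`, and for a suitable power `λ` of
`t` both terms tend to `0`. -/
theorem IsGasFlow.eq_zero {d : ℕ} {κ R : ℝ} {B : ℝ × Space d → ℝ} {U : ℝ × Space d → Space d}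
    (h : IsGasFlow κ R B U) (hd : Odd d) (hdκ : ((d : ℝ) - 1) * κ < 1) (q : ℝ × Space d) :
    B q = 0 := by
  by_contra hq
  have hκ := h.kappa_pos
  have hp : 0 < κ⁻¹ := inv_pos.2 hκ
  obtain ⟨φ, C₁, hφi, hφ0, hφ1, hφC⟩ := h.exists_volume_le hd
  obtain ⟨C₂, hC₂⟩ := h.exists_pressure_le
  set m := max 0 (2 - 2 * (d : ℝ) * κ) with hm
  have hint : ∀ t, Integrable fun x => |B (t, x)| ^ κ⁻¹ :=
    h.integrable_slice (h.continuous_abs_B_rpow hp)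
      fun q hq => by simp only [hq, abs_zero, Real.zero_rpow hp.ne']
  have hmass : 0 < ∫ x, |B (q.1, x)| ^ κ⁻¹ := by
    have hc : Continuous fun x => |B (q.1, x)| ^ κ⁻¹ :=
      (h.continuous_abs_B_rpow hp).comp (by fun_prop : Continuous fun x : Space d => (q.1, x))
    have hs : HasBoundedSlices fun q => |B q| ^ κ⁻¹ :=
      h.hasBoundedSlices.mono fun q hq => by simp only [hq, abs_zero, Real.zero_rpow hp.ne']
    have hne : |B (q.1, q.2)| ^ κ⁻¹ ≠ 0 := (Real.rpow_pos_of_pos (abs_pos.2 hq) _).ne'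
    exact hc.integral_pos_of_hasCompactSupport_nonneg_nonzero (hs.hasCompactSupport q.1)
      (fun x => by positivity) hne
  -- the window for `σ` is open because `(d - 1) κ < 1`
  obtain ⟨σ, hσ1, hσ2⟩ : ∃ σ, ((d : ℝ) - 1) * κ < σ ∧ σ < min 1 (d * κ) :=
    exists_between (lt_min hdκ (by linarith))
  rw [lt_min_iff] at hσ2
  have he₂ : 0 < -(2 * σ + (m - 2)) := by
    have : m < 2 - 2 * σ := max_lt (by linarith) (by linarith)
    linarith
  have he₁ : 0 < -((d : ℝ) - 1 - σ * κ⁻¹) := by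
    have : (d : ℝ) - 1 < σ * κ⁻¹ := by rwa [← div_eq_mul_inv, lt_div_iff₀ hκ]
    linarith
  have hle : ∀ t, 1 ≤ t → ∫ x, |B (q.1, x)| ^ κ⁻¹
      ≤ C₂ * t ^ (2 * σ + (m - 2)) + C₁ * t ^ ((d : ℝ) - 1 - σ * κ⁻¹) := by
    intro t ht
    have ht0 : 0 < t := by linarith
    have hpt : ∀ x, |B (t, x)| ^ κ⁻¹
        ≤ t ^ (2 * σ) * |B (t, x)| ^ (κ⁻¹ + 2) + t ^ (-(σ * κ⁻¹)) * φ t x := by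
      intro x
      rcases eq_or_ne (B (t, x)) 0 with h0 | h0
      · have := hφ0 t x
        rw [h0, abs_zero, Real.zero_rpow hp.ne']
        positivity
      rw [hφ1 t x h0, mul_one, abs_rpow_add_two hp]
      -- the threshold is `λ = t ^ (-σ)`
      rcases le_total |B (t, x)| (t ^ (-σ)) with hb | hb
      · refine le_add_of_nonneg_of_le (by positivity) ?_
        rw [← neg_mul, Real.rpow_mul ht0.le]
        gcongr
      · refine le_add_of_le_of_nonneg ?_ (by positivity)
        have h1 : 1 ≤ t ^ (2 * σ) * B (t, x) ^ 2 := by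
          calc (1 : ℝ) = t ^ (2 * σ) * (t ^ (-σ)) ^ 2 := by
                rw [← Real.rpow_natCast (t ^ (-σ)), ← Real.rpow_mul ht0.le, ← Real.rpow_add ht0]
                norm_num
                ring_nf
                simp
            _ ≤ t ^ (2 * σ) * |B (t, x)| ^ 2 := by gcongr
            _ = _ := by rw [sq_abs]
        calc |B (t, x)| ^ κ⁻¹ = |B (t, x)| ^ κ⁻¹ * 1 := (mul_one _).symm
          _ ≤ |B (t, x)| ^ κ⁻¹ * (t ^ (2 * σ) * B (t, x) ^ 2) := by gcongr
          _ = _ := by ring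
    have hpow : t ^ (d - 1) = t ^ ((d : ℝ) - 1) := by
      rw [← Real.rpow_natCast, Nat.cast_sub hd.pos, Nat.cast_one]
    have hV := hφC t ht
    rw [hpow] at hV
    rw [h.integral_density_eq q.1 t]
    calc ∫ x, |B (t, x)| ^ κ⁻¹
        ≤ ∫ x, (t ^ (2 * σ) * |B (t, x)| ^ (κ⁻¹ + 2) + t ^ (-(σ * κ⁻¹)) * φ t x) :=
          integral_mono (hint t)
            (((h.integrable_pressure t).const_mul _).add ((hφi t).const_mul _)) hpt
      _ = t ^ (2 * σ) * (∫ x, |B (t, x)| ^ (κ⁻¹ + 2)) + t ^ (-(σ * κ⁻¹)) * ∫ x, φ t x := by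
          rw [integral_add ((h.integrable_pressure t).const_mul _) ((hφi t).const_mul _),
            integral_const_mul, integral_const_mul]
      _ ≤ t ^ (2 * σ) * (C₂ * t ^ (m - 2)) + t ^ (-(σ * κ⁻¹)) * (C₁ * t ^ ((d : ℝ) - 1)) := by
          gcongr
          exact hC₂ t ht
      _ = _ := by
          rw [Real.rpow_add ht0, sub_eq_add_neg _ (σ * κ⁻¹), Real.rpow_add ht0]
          ring
  have hlim : Tendsto (fun t : ℝ => C₂ * t ^ (2 * σ + (m - 2))
      + C₁ * t ^ ((d : ℝ) - 1 - σ * κ⁻¹)) atTop (𝓝 (C₂ * 0 + C₁ * 0)) := by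
    have h1 := tendsto_rpow_neg_atTop he₁
    have h2 := tendsto_rpow_neg_atTop he₂
    rw [neg_neg] at h1 h2
    exact (h2.const_mul _).add (h1.const_mul _)
  have := ge_of_tendsto hlim ((eventually_ge_atTop 1).mono hle)
  linarith

end EulerVacuum

theorem mainTheorem1 (d : ℕ) (hd : Odd d) (γ : ℝ) (hγ : 1 < γ)
    (hγd : d = 1 ∨ γ ≤ 1 + 1 / ((d : ℝ) - 1)) :
    ¬ ∃ (c : ℝ → EuclideanSpace ℝ (Fin d) → ℝ)
        (u : ℝ → EuclideanSpace ℝ (Fin d) → EuclideanSpace ℝ (Fin d)),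
      EulerVacuum.IsEternalSolution γ c u ∧
      (∃ K : Set (EuclideanSpace ℝ (Fin d)),
        EulerVacuum.IsCompactSmoothDomain K ∧ tsupport (c 0) ⊆ K) ∧
      (∃ t x, c t x ≠ 0) := by
  rintro ⟨c, u, hsol, ⟨K, hK, hcK⟩, t, x, htx⟩
  obtain ⟨R, hR⟩ := hK.1.isBounded.subset_closedBall (0 : EuclideanSpace ℝ (Fin d))
  have hvac : ∀ y, R < ‖y‖ → c 0 y = 0 := fun y hy =>
    image_eq_zero_of_notMem_tsupport fun hy' => by
      have := hR (hcK hy')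
      rw [mem_closedBall_zero_iff] at this
      linarith
  have hflow := hsol.isGasFlow hγ hvac
  have hdκ : ((d : ℝ) - 1) * EulerVacuum.kappa γ < 1 := by
    rcases eq_or_ne d 1 with rfl | hne
    · simp
    · have h1 : (1 : ℝ) < d := by
        have := hd.pos
        exact_mod_cast (by omega : 1 < d)
      have h2 := hγd.resolve_left hne
      have h3 : (γ - 1) * ((d : ℝ) - 1) ≤ 1 := by
        rw [← le_div_iff₀ (by linarith)]
        linarith
      rw [EulerVacuum.kappa]
      linarith
  have h0 := hflow.eq_zero hd hdκ (t, x)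
  simp only [EulerVacuum.renorm, div_eq_zero_iff] at h0
  exact h0.elim htx (EulerVacuum.kappa_pos hγ).ne'
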